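/- Consider the class of equations \[ u_t=a^2(t)u_{xx}+b(t)u-c(t)u^3 , \qquad (*) \] where $a,b,c$ are smooth real functions on an open interval and $a$ and $c$ vanish nowhere. Point transformations are diffeomorphisms $\Phi$ between open subsets of the space of $(t,x,u)$, with connected domain. Such a $\Phi$ maps an equation $E$ of the class to an equation $\tilde E$ of the class if its domain and its image lie over the time intervals of $E$ and $\tilde E$ and its second prolongation, wherever it is defined, maps the submanifold of the second-order jet space given by $E$ to the one given by $\tilde E$. The equivalence groupoid of the class is the set of all such triples $(E,\tilde E,\Phi)$. The (usual) equivalence group $G^\sim$ is the pseudogroup of point transformations of the space of $(t,x,u,a,b,c)$, defined for all values of the arbitrary elements $a,b,c$ with $a\neq0$, $c\neq0$, whose $(t,x,u)$-components depend on $(t,x,u)$ only and form a point transformation that maps every equation of the class defined on its domain to the equation of the class with the transformed arbitrary elements. \textbf{Theorem.} The equivalence group $G^\sim$ of the class $(*)$ is formed by the transformations \[ \tilde t=\theta(t),\quad \tilde x=\delta_1x+\delta_2,\quad \tilde u=\varphi(t)u, \] \[ \tilde a^2(\tilde t)=\frac{\delta_1^2}{\theta_t}a^2(t),\quad \tilde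 b(\tilde t)=\frac{1}{\varphi\theta_t}\bigl(\varphi b(t)+\varphi_t\bigr),\quad \tilde c(\tilde t)=\frac{1}{\varphi^2\theta_t}c(t), \] where $\delta_1\neq0$ and $\delta_2$ are arbitrary constants and $\theta$ and $\varphi$ are arbitrary smooth functions of $t$, on the projection of the domain to the $t$-axis, with $\theta_t\varphi\neq0$; here $\theta_t>0$, as the formula for $\tilde a^2$ requires, and all such parameters occur. These transformations generate the equivalence groupoid of the class, that is, the class is normalized: a point transformation maps an equation $E$ of the class to an equation $\tilde E$ of the class if and only if it is the $(t,x,u)$-part of an element of $G^\sim$ that transforms the arbitrary elements of $E$ into those of $\tilde E$. Equivalently, it has the form above for some $\delta_1,\delta_2,\theta,\varphi$ as above, and the coefficients of $E$ and $\tilde E$ are related by the formulas above for all $t$ in the projection of its domain. -/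

import Mathlib

open Set
open scoped ContDiff

noncomputable section

namespace NWS

/-- An equation `u_t = a(t)^2 u_xx + b(t) u - c(t) u^3` of the class: the coefficients are smooth
real functions on an open interval (only their values there matter), and `a`, `c` do not vanish. -/
structure Equation where
  timeDomain : Set ℝ
  isOpen_timeDomain : IsOpen timeDomain
  isConnected_timeDomain : IsConnected timeDomain
  a : ℝ → ℝ
  b : ℝ → ℝ
  c : ℝ → ℝ
  smooth_a : ContDiffOn ℝ ∞ a timeDomain
  smooth_b : ContDiffOn ℝ ∞ b timeDomain
  smooth_c : ContDiffOn ℝ ∞ c timeDomain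
  a_ne_zero : ∀ t ∈ timeDomain, a t ≠ 0
  c_ne_zero : ∀ t ∈ timeDomain, c t ≠ 0

/-- A (local) nondegenerate point transformation of the space `V`: a smooth injective map on an
open set with everywhere invertible differential, i.e. a diffeomorphism between open sets. -/
structure PointTransformation (V : Type*) [NormedAddCommGroup V] [NormedSpace ℝ V] where
  source : Set V
  toFun : V → V
  isOpen_source : IsOpen source
  smooth : ContDiffOn ℝ ∞ toFun source
  injOn : InjOn toFun source
  nondegenerate : ∀ p ∈ source, Function.Bijective (fderiv ℝ toFun p)

/-- The space of the variables `(t, x, u)`. -/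
abbrev Base : Type := ℝ × ℝ × ℝ

/-- The first-order jet space, with coordinates `(t, x, u, u_t, u_x)`. -/
abbrev Jet1 : Type := ℝ × ℝ × ℝ × ℝ × ℝ

/-- The second-order jet space, for one function `u` of `(t, x)`. -/
@[ext]
structure Jet2 where
  t : ℝ
  x : ℝ
  u : ℝ
  ut : ℝ
  ux : ℝ
  utt : ℝ
  utx : ℝ
  uxx : ℝ

/-- The projection of a first-order jet to `(t, x, u)`. -/
def Jet1.base (j : Jet1) : Base := (j.1, j.2.1, j.2.2.1)

/-- The projection of a second-order jet to the first-order jet space. -/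
def Jet2.toJet1 (j : Jet2) : Jet1 := (j.t, j.x, j.u, j.ut, j.ux)

/-- The total derivative `D_t F = F_t + u_t F_u` of a function `F` of `(t, x, u)`. -/
def totalDt0 (F : Base → ℝ) (j : Jet1) : ℝ := fderiv ℝ F j.base (1, 0, j.2.2.2.1)

/-- The total derivative `D_x F = F_x + u_x F_u` of a function `F` of `(t, x, u)`. -/
def totalDx0 (F : Base → ℝ) (j : Jet1) : ℝ := fderiv ℝ F j.base (0, 1, j.2.2.2.2)

/-- The total derivative `D_t G = G_t + u_t G_u + u_tt G_{u_t} + u_tx G_{u_x}` of a function `G`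
of `(t, x, u, u_t, u_x)`. -/
def totalDt1 (G : Jet1 → ℝ) (j : Jet2) : ℝ :=
  fderiv ℝ G j.toJet1 (1, 0, j.ut, j.utt, j.utx)

/-- The total derivative `D_x G = G_x + u_x G_u + u_tx G_{u_t} + u_xx G_{u_x}` of a function `G`
of `(t, x, u, u_t, u_x)`. -/
def totalDx1 (G : Jet1 → ℝ) (j : Jet2) : ℝ :=
  fderiv ℝ G j.toJet1 (0, 1, j.ux, j.utx, j.uxx)

namespace PointTransformation

variable (Φ : PointTransformation Base)

/-- The component `t̃ = T(t, x, u)`. -/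
def T (p : Base) : ℝ := (Φ.toFun p).1

/-- The component `x̃ = X(t, x, u)`. -/
def X (p : Base) : ℝ := (Φ.toFun p).2.1

/-- The component `ũ = U(t, x, u)`. -/
def U (p : Base) : ℝ := (Φ.toFun p).2.2

/-- The total Jacobian `D_t T D_x X - D_x T D_t X`. The transformation can be prolonged to a jet
over a point of its domain exactly if this does not vanish there. -/
def totalJacobian (j : Jet1) : ℝ :=
  totalDt0 Φ.T j * totalDx0 Φ.X j - totalDx0 Φ.T j * totalDt0 Φ.X j

/-- The transformed derivative `ũ_t̃`, a function of `(t, x, u, u_t, u_x)`. -/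
def newUt (j : Jet1) : ℝ :=
  (totalDx0 Φ.X j * totalDt0 Φ.U j - totalDt0 Φ.X j * totalDx0 Φ.U j) / Φ.totalJacobian j

/-- The transformed derivative `ũ_x̃`, a function of `(t, x, u, u_t, u_x)`. -/
def newUx (j : Jet1) : ℝ :=
  (totalDt0 Φ.T j * totalDx0 Φ.U j - totalDx0 Φ.T j * totalDt0 Φ.U j) / Φ.totalJacobian j

/-- The derivative with respect to the new variable `t̃` of a function of `(t, x, u, u_t, u_x)`. -/
def newDt (G : Jet1 → ℝ) (j : Jet2) : ℝ :=
  (totalDx0 Φ.X j.toJet1 * totalDt1 G j - totalDt0 Φ.X j.toJet1 * totalDx1 G j) /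
    Φ.totalJacobian j.toJet1

/-- The derivative with respect to the new variable `x̃` of a function of `(t, x, u, u_t, u_x)`. -/
def newDx (G : Jet1 → ℝ) (j : Jet2) : ℝ :=
  (totalDt0 Φ.T j.toJet1 * totalDx1 G j - totalDx0 Φ.T j.toJet1 * totalDt1 G j) /
    Φ.totalJacobian j.toJet1

/-- The second prolongation of a point transformation, in the standard form by total
derivatives. -/
def prolong (j : Jet2) : Jet2 where
  t := Φ.T j.toJet1.base
  x := Φ.X j.toJet1.base
  u := Φ.U j.toJet1.base
  ut := Φ.newUt j.toJet1
  ux := Φ.newUx j.toJet1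
  utt := Φ.newDt Φ.newUt j
  utx := Φ.newDx Φ.newUt j
  uxx := Φ.newDx Φ.newUx j

end PointTransformation

/-- The manifold that an equation defines in the second-order jet space. -/
def Equation.manifold (E : Equation) : Set Jet2 :=
  {j | j.t ∈ E.timeDomain ∧
    j.ut = E.a j.t ^ 2 * j.uxx + E.b j.t * j.u - E.c j.t * j.u ^ 3}

/-- The domain of `Φ` lies over the time interval of `E`, its image over that of `E'`. -/
def Fits (Φ : PointTransformation Base) (E E' : Equation) : Prop :=
  ∀ p ∈ Φ.source, p.1 ∈ E.timeDomain ∧ Φ.T p ∈ E'.timeDomain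

/-- `Φ` maps `E` to `E'`: wherever its second prolongation is defined, it maps the manifold of `E`
into that of `E'` and the complement of the former into the complement of the latter. -/
def MapsEquation (Φ : PointTransformation Base) (E E' : Equation) : Prop :=
  Fits Φ E E' ∧ ∀ j : Jet2, j.toJet1.base ∈ Φ.source → Φ.totalJacobian j.toJet1 ≠ 0 →
    (j ∈ E.manifold ↔ Φ.prolong j ∈ E'.manifold)

/-- The equivalence groupoid of the class: the triples of an initial equation, a target equation
and a point transformation, with connected domain, that maps the former to the latter. -/
def equivalenceGroupoid : Set (Equation × Equation × PointTransformation Base) :=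
  {g | IsConnected g.2.2.source ∧ MapsEquation g.2.2 g.1 g.2.1}

/-- The admissible values `(α, β, γ)` of the arbitrary elements `(a, b, c)`. -/
def elementValues : Set (ℝ × ℝ × ℝ) := {q | q.1 ≠ 0 ∧ q.2.2 ≠ 0}

/-- A point transformation of the extended space of `(t, x, u)` and the values `(α, β, γ)` of the
arbitrary elements, projectable to the space of `(t, x, u)`. -/
structure ExtendedTransformation where
  base : PointTransformation Base
  total : PointTransformation (Base × (ℝ × ℝ × ℝ))
  source_total : total.source = base.source ×ˢ elementValues
  projectable : ∀ z ∈ total.source, (total.toFun z).1 = base.toFun z.1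

/-- `Ψ` transforms the arbitrary elements of `E` into those of `E'`, on the domain of `Ψ`. -/
def ExtendedTransformation.TransformsElements (Ψ : ExtendedTransformation)
    (E E' : Equation) : Prop :=
  Fits Ψ.base E E' ∧ ∀ p ∈ Ψ.base.source,
    (Ψ.total.toFun (p, (E.a p.1, E.b p.1, E.c p.1))).2 =
      (E'.a (Ψ.base.T p), E'.b (Ψ.base.T p), E'.c (Ψ.base.T p))

/-- The (usual) equivalence group of the class, as a pseudogroup of local transformations of the
extended space: the transformations that map every equation of the class whose coefficients are
defined on the domain to an equation of the class, namely to the one whose arbitrary elements are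
the transformed ones. -/
def equivalenceGroup : Set ExtendedTransformation :=
  {Ψ | IsConnected Ψ.base.source ∧
    ∀ E : Equation, (∀ p ∈ Ψ.base.source, p.1 ∈ E.timeDomain) →
      ∃ E' : Equation, Ψ.TransformsElements E E' ∧ MapsEquation Ψ.base E E'}

/-- The standing conditions on the parameters, over a set `J` of times: `δ₁ ≠ 0`, and `θ`, `φ` are
smooth on `J` with `θ_t φ ≠ 0`. -/
structure IsParameters (J : Set ℝ) (θ φ : ℝ → ℝ) (δ₁ : ℝ) : Prop where
  delta_ne_zero : δ₁ ≠ 0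
  smooth_theta : ContDiffOn ℝ ∞ θ J
  smooth_phi : ContDiffOn ℝ ∞ φ J
  ne_zero : ∀ t ∈ J, deriv θ t * φ t ≠ 0

/-- `t̃ = θ(t)`, `x̃ = δ₁ x + δ₂`, `ũ = φ(t) u`. -/
def HasForm (Φ : PointTransformation Base) (θ φ : ℝ → ℝ) (δ₁ δ₂ : ℝ) : Prop :=
  ∀ t x u : ℝ, (t, x, u) ∈ Φ.source → Φ.toFun (t, x, u) = (θ t, δ₁ * x + δ₂, φ t * u)

/-- The relations between the values `(α, β, γ)` and `(α', β', γ')` of the initial and the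
transformed arbitrary elements at the time `t`. -/
def ElementFormulas (θ φ : ℝ → ℝ) (δ₁ t : ℝ) (q q' : ℝ × ℝ × ℝ) : Prop :=
  q'.1 ^ 2 = δ₁ ^ 2 / deriv θ t * q.1 ^ 2 ∧
  q'.2.1 = 1 / (φ t * deriv θ t) * (φ t * q.2.1 + deriv φ t) ∧
  q'.2.2 = 1 / (φ t ^ 2 * deriv θ t) * q.2.2

/-- The extended transformation `Ψ` is given by the formulas with parameters `θ, φ, δ₁, δ₂`. -/
def ExtendedTransformation.IsGivenBy (Ψ : ExtendedTransformation) (θ φ : ℝ → ℝ)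
    (δ₁ δ₂ : ℝ) : Prop :=
  HasForm Ψ.base θ φ δ₁ δ₂ ∧
    ∀ p ∈ Ψ.base.source, ∀ q ∈ elementValues,
      ElementFormulas θ φ δ₁ p.1 q (Ψ.total.toFun (p, q)).2

end NWS

end

/-! If `Φ` maps `E` to `E'`, the prolonged equation is an identity in the jet variables that `E`
leaves free; splitting it determines `Φ`. Only ũ_x̃x̃ can involve u_tt, with a coefficient
proportional to (D_x T)² times the Jacobian, so T_x = T_u = 0. The coefficient of u_xx gives a² (D_x
X)² = a'(T)² T_t for all admissible u_x, so X_u = 0, and then X_xx = 0. The powers of u_x give U_uu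
= 0 and tie X_t to U_xu (`MapsEquation.determining`). What remains is a cubic polynomial in u,
because U is affine in u: its two top coefficients give c = T_t c'(T) U_u² and U = u U_u
(`MapsEquation.U_eq`). The relation for c makes U_u locally independent of x, so U_xu = 0 and X_t =
0.

All this is local, whereas the fibre of a connected domain over a time may be disconnected.
Connectedness makes X_x a constant δ₁. With antiderivatives F of a² and G of a'², the function G(T)
- δ₁² F(t) is constant, and G is strictly increasing, so T is a function of t alone
(`MapsEquation.T_eq_of_fst_eq`). The relation for c then determines U_u² by t, and the sign of the
nonvanishing U_u cannot change (`MapsEquation.exists_form`).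

Conversely, for transformations of this form the pulled-back equation is φ/θ_t times the initial
one. For the group, equations with constant coefficients already realize all values of the arbitrary
elements at every point. Normalization is then a matter of extending `Φ` to the arbitrary elements;
the formulas fix only the square of the new a, so its sign is chosen to fit `E'`. -/

namespace NWS

open Filter Topology

/-! ### Directional derivatives on the base -/

section Directional

variable {V : Type*} [NormedAddCommGroup V] [NormedSpace ℝ V]

/-- The derivative of `F` in the direction `v`, as a function of the point. -/
noncomputable def dirDeriv (v : V) (F : V → ℝ) (p : V) : ℝ := fderiv ℝ F p v

variable {S : Set V} {F G : V → ℝ} {p v w : V}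

theorem smooth_dirDeriv (hS : IsOpen S) (hF : ContDiffOn ℝ ∞ F S) (v : V) :
    ContDiffOn ℝ ∞ (dirDeriv v F) S :=
  (hF.fderiv_of_isOpen hS (m := ∞) le_rfl).clm_apply contDiffOn_const

theorem differentiableAt_of_smooth (hS : IsOpen S) (hF : ContDiffOn ℝ ∞ F S) (hp : p ∈ S) :
    DifferentiableAt ℝ F p :=
  (hF.contDiffAt (hS.mem_nhds hp)).differentiableAt (by simp)

theorem dirDeriv_comm (hS : IsOpen S) (hF : ContDiffOn ℝ ∞ F S) (hp : p ∈ S) :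
    dirDeriv v (dirDeriv w F) p = dirDeriv w (dirDeriv v F) p := by
  have hd : DifferentiableAt ℝ (fderiv ℝ F) p :=
    ((hF.fderiv_of_isOpen hS (m := ∞) le_rfl).contDiffAt (hS.mem_nhds hp)).differentiableAt
      (by simp)
  have hs : IsSymmSndFDerivAt ℝ F p :=
    (hF.contDiffAt (hS.mem_nhds hp)).isSymmSndFDerivAt (by
      rw [minSmoothness_of_isRCLikeNormedField]
      exact WithTop.coe_le_coe.2 (le_top : (2 : ℕ∞) ≤ ⊤))
  have key : ∀ a b : V, dirDeriv a (dirDeriv b F) p = fderiv ℝ (fderiv ℝ F) p a b := by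
    intro a b
    have h := hd.hasFDerivAt.clm_apply (hasFDerivAt_const b p)
    have h' : HasFDerivAt (dirDeriv b F) _ p := h
    rw [dirDeriv, h'.fderiv]
    simp
  rw [key, key]
  exact hs v w

theorem dirDeriv_congr (hS : IsOpen S) (h : EqOn F G S) (hp : p ∈ S) :
    dirDeriv v F p = dirDeriv v G p := by
  have : F =ᶠ[𝓝 p] G := Filter.eventuallyEq_of_mem (hS.mem_nhds hp) h
  rw [dirDeriv, dirDeriv, this.fderiv_eq]

theorem dirDeriv_eq_zero (hS : IsOpen S) {k : ℝ} (h : ∀ q ∈ S, F q = k) (hp : p ∈ S) :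
    dirDeriv v F p = 0 := by
  rw [dirDeriv_congr (G := fun _ => k) hS h hp]
  simp [dirDeriv]

theorem hasDerivAt_line (hS : IsOpen S) (hF : ContDiffOn ℝ ∞ F S) {s : ℝ} (hp : p + s • v ∈ S) :
    HasDerivAt (fun r : ℝ => F (p + r • v)) (dirDeriv v F (p + s • v)) s := by
  have h1 : HasDerivAt (fun r : ℝ => p + r • v) v s := by
    simpa using ((hasDerivAt_id s).smul_const v).const_add p
  exact (differentiableAt_of_smooth hS hF hp).hasFDerivAt.comp_hasDerivAt s h1

theorem eventually_line_mem (hS : IsOpen S) (hp : p ∈ S) (v : V) :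
    ∀ᶠ s : ℝ in 𝓝 0, p + s • v ∈ S := by
  have : ContinuousAt (fun s : ℝ => p + s • v) 0 := by fun_prop
  exact this.eventually_mem (by simpa using hS.mem_nhds hp)

theorem eventually_line_eq (hS : IsOpen S) (hF : ContDiffOn ℝ ∞ F S)
    (h : ∀ q ∈ S, dirDeriv v F q = 0) (hp : p ∈ S) :
    ∀ᶠ s : ℝ in 𝓝 0, F (p + s • v) = F p := by
  obtain ⟨ε, hε, hb⟩ := Metric.eventually_nhds_iff_ball.1 (eventually_line_mem hS hp v)
  refine Metric.eventually_nhds_iff_ball.2 ⟨ε, hε, fun s hs => ?_⟩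
  have hd : ∀ r ∈ Metric.ball (0 : ℝ) ε, HasDerivAt (fun r : ℝ => F (p + r • v)) 0 r := by
    intro r hr
    have := hasDerivAt_line hS hF (hb r hr)
    rwa [h _ (hb r hr)] at this
  have := Metric.isOpen_ball.is_const_of_deriv_eq_zero
    (convex_ball (0 : ℝ) ε).isPreconnected
    (fun r hr => (hd r hr).differentiableAt.differentiableWithinAt)
    (fun r hr => (hd r hr).deriv) hs (Metric.mem_ball_self hε)
  simpa using this

theorem eventually_line_affine (hS : IsOpen S) (hF : ContDiffOn ℝ ∞ F S)
    (h : ∀ q ∈ S, dirDeriv v (dirDeriv v F) q = 0) (hp : p ∈ S) :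
    ∀ᶠ s : ℝ in 𝓝 0, F (p + s • v) = F p + s * dirDeriv v F p := by
  obtain ⟨ε, hε, hb⟩ := Metric.eventually_nhds_iff_ball.1
    ((eventually_line_mem hS hp v).and (eventually_line_eq hS (smooth_dirDeriv hS hF v) h hp))
  refine Metric.eventually_nhds_iff_ball.2 ⟨ε, hε, fun s hs => ?_⟩
  have hd : ∀ r ∈ Metric.ball (0 : ℝ) ε,
      HasDerivAt (fun r : ℝ => F (p + r • v) - r * dirDeriv v F p) 0 r := by
    intro r hr
    have h1 := hasDerivAt_line hS hF (hb r hr).1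
    rw [(hb r hr).2] at h1
    have h2 := h1.fun_sub ((hasDerivAt_id' r).mul_const (dirDeriv v F p))
    simpa using h2
  have := Metric.isOpen_ball.is_const_of_deriv_eq_zero
    (convex_ball (0 : ℝ) ε).isPreconnected
    (fun r hr => (hd r hr).differentiableAt.differentiableWithinAt)
    (fun r hr => (hd r hr).deriv) hs (Metric.mem_ball_self hε)
  simp only [zero_smul, add_zero, zero_mul, sub_zero] at this
  linarith

/-- Differentiating the square gives 2 F ∂_v F = 0. The determining equations control X_x and U_u
only through their squares. -/
theorem dirDeriv_eq_zero_of_sq_eventually_const (hS : IsOpen S) (hF : ContDiffOn ℝ ∞ F S)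
    (hp : p ∈ S) (h0 : F p ≠ 0) (h : ∀ᶠ s : ℝ in 𝓝 0, F (p + s • v) ^ 2 = F p ^ 2) :
    dirDeriv v F p = 0 := by
  have h1 : HasDerivAt (fun r : ℝ => F (p + r • v)) (dirDeriv v F p) 0 := by
    simpa using hasDerivAt_line (p := p) (v := v) (s := 0) hS hF (by simpa using hp)
  have h2 := h1.pow 2
  have h3 : HasDerivAt (fun r : ℝ => F (p + r • v) ^ 2) 0 0 :=
    (hasDerivAt_const (0 : ℝ) (F p ^ 2)).congr_of_eventuallyEq h
  have h4 := h2.unique h3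
  simpa [h0] using h4

end Directional

/-- The unit vector of the `t`-axis. -/
noncomputable def et : Base := (1, 0, 0)

/-- The unit vector of the `x`-axis. -/
noncomputable def ex : Base := (0, 1, 0)

/-- The unit vector of the `u`-axis. -/
noncomputable def eu : Base := (0, 0, 1)

theorem base_eq (a b c : ℝ) : ((a, b, c) : Base) = a • et + b • ex + c • eu := by
  simp [et, ex, eu]

theorem fderiv_base_apply (F : Base → ℝ) (p : Base) (a b c : ℝ) :
    fderiv ℝ F p (a, b, c) = a * dirDeriv et F p + b * dirDeriv ex F p + c * dirDeriv eu F p := by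
  rw [base_eq, map_add, map_add, map_smul, map_smul, map_smul]
  rfl

theorem fderiv_eq_zero_of_dirDeriv {F : Base → ℝ} {p : Base} (ht : dirDeriv et F p = 0)
    (hx : dirDeriv ex F p = 0) (hu : dirDeriv eu F p = 0) : fderiv ℝ F p = 0 := by
  refine ContinuousLinearMap.ext fun ⟨a, b, c⟩ => ?_
  rw [fderiv_base_apply, ht, hx, hu]
  simp

theorem totalDt0_eq (F : Base → ℝ) (j : Jet1) :
    totalDt0 F j = dirDeriv et F j.base + j.2.2.2.1 * dirDeriv eu F j.base := by
  simp [totalDt0, fderiv_base_apply]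

theorem totalDx0_eq (F : Base → ℝ) (j : Jet1) :
    totalDx0 F j = dirDeriv ex F j.base + j.2.2.2.2 * dirDeriv eu F j.base := by
  simp [totalDx0, fderiv_base_apply]

/-- The projection of the first-order jet space to the base, as a continuous linear map. -/
noncomputable def baseL : Jet1 →L[ℝ] Base :=
  (ContinuousLinearMap.fst ℝ ℝ _).prod
    (((ContinuousLinearMap.fst ℝ ℝ _).comp (ContinuousLinearMap.snd ℝ ℝ _)).prod
      ((ContinuousLinearMap.fst ℝ ℝ _).comp
        ((ContinuousLinearMap.snd ℝ ℝ _).comp (ContinuousLinearMap.snd ℝ ℝ _))))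

/-- The coordinate `u_x` of the first-order jet space, as a continuous linear map. -/
noncomputable def uxL : Jet1 →L[ℝ] ℝ :=
  ContinuousLinearMap.snd ℝ ℝ ℝ ∘L ContinuousLinearMap.snd ℝ ℝ (ℝ × ℝ) ∘L
    ContinuousLinearMap.snd ℝ ℝ (ℝ × ℝ × ℝ) ∘L ContinuousLinearMap.snd ℝ ℝ (ℝ × ℝ × ℝ × ℝ)

theorem uxL_apply (j : Jet1) : uxL j = j.2.2.2.2 := rfl

theorem hasFDerivAt_base (j : Jet1) : HasFDerivAt Jet1.base baseL j :=
  baseL.hasFDerivAt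

section

variable {S : Set Base} {F : Base → ℝ} {j : Jet1}

theorem differentiableAt_comp_base (hS : IsOpen S) (hF : ContDiffOn ℝ ∞ F S) (hj : j.base ∈ S) :
    DifferentiableAt ℝ (fun k : Jet1 => F k.base) j :=
  (differentiableAt_of_smooth hS hF hj).comp j (hasFDerivAt_base j).differentiableAt

theorem differentiableAt_totalDt0 (hS : IsOpen S) (hF : ContDiffOn ℝ ∞ F S) (hj : j.base ∈ S) :
    DifferentiableAt ℝ (totalDt0 F) j := by
  rw [funext (totalDt0_eq F)]
  have h1 := differentiableAt_comp_base hS (smooth_dirDeriv hS hF et) hj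
  have h2 := differentiableAt_comp_base hS (smooth_dirDeriv hS hF eu) hj
  fun_prop

theorem differentiableAt_totalDx0 (hS : IsOpen S) (hF : ContDiffOn ℝ ∞ F S) (hj : j.base ∈ S) :
    DifferentiableAt ℝ (totalDx0 F) j := by
  rw [funext (totalDx0_eq F)]
  have h1 := differentiableAt_comp_base hS (smooth_dirDeriv hS hF ex) hj
  have h2 := differentiableAt_comp_base hS (smooth_dirDeriv hS hF eu) hj
  fun_prop

/-- Chain rule for F_x + u_x F_u; as this does not involve u_t, no u_tx appears. -/
theorem totalDx1_totalDx0 (hS : IsOpen S) (hF : ContDiffOn ℝ ∞ F S) {j : Jet2}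
    (hj : j.toJet1.base ∈ S) :
    totalDx1 (totalDx0 F) j = dirDeriv ex (dirDeriv ex F) j.toJet1.base
      + 2 * j.ux * dirDeriv ex (dirDeriv eu F) j.toJet1.base
      + j.ux ^ 2 * dirDeriv eu (dirDeriv eu F) j.toJet1.base
      + j.uxx * dirDeriv eu F j.toJet1.base := by
  have hx := smooth_dirDeriv hS hF ex
  have hu := smooth_dirDeriv hS hF eu
  have h1 : HasFDerivAt (fun k : Jet1 => dirDeriv ex F k.base)
      ((fderiv ℝ (dirDeriv ex F) j.toJet1.base).comp baseL) j.toJet1 :=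
    (differentiableAt_of_smooth hS hx hj).hasFDerivAt.comp j.toJet1 (hasFDerivAt_base j.toJet1)
  have h2 : HasFDerivAt (fun k : Jet1 => dirDeriv eu F k.base)
      ((fderiv ℝ (dirDeriv eu F) j.toJet1.base).comp baseL) j.toJet1 :=
    (differentiableAt_of_smooth hS hu hj).hasFDerivAt.comp j.toJet1 (hasFDerivAt_base j.toJet1)
  have h3 : HasFDerivAt (fun k : Jet1 => k.2.2.2.2) uxL j.toJet1 := uxL.hasFDerivAt
  have h4 := h1.fun_add (h3.fun_mul h2)
  rw [totalDx1, funext (totalDx0_eq F), h4.fderiv]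
  have hb : baseL (0, 1, j.ux, j.utx, j.uxx) = (0, 1, j.ux) := rfl
  simp only [add_apply, smul_apply, ContinuousLinearMap.comp_apply, hb, fderiv_base_apply,
    uxL_apply, smul_eq_mul]
  rw [dirDeriv_comm (v := eu) (w := ex) hS hF hj]
  simp only [Jet2.toJet1]
  ring

end

theorem hasDerivAt_line_zero {V W : Type*} [NormedAddCommGroup V] [NormedSpace ℝ V]
    [NormedAddCommGroup W] [NormedSpace ℝ W] {G : V → W} {p : V}
    (hG : DifferentiableAt ℝ G p) (v : V) :
    HasDerivAt (fun s : ℝ => G (p + s • v)) (fderiv ℝ G p v) 0 := by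
  have h1 : HasDerivAt (fun r : ℝ => p + r • v) v 0 := by
    simpa using ((hasDerivAt_id (0 : ℝ)).smul_const v).const_add p
  have h2 : HasFDerivAt G (fderiv ℝ G p) (p + (0 : ℝ) • v) := by simpa using hG.hasFDerivAt
  exact h2.comp_hasDerivAt (0 : ℝ) h1

theorem fderiv_div_apply {V : Type*} [NormedAddCommGroup V] [NormedSpace ℝ V] {N M : V → ℝ}
    {p : V} (hN : DifferentiableAt ℝ N p) (hM : DifferentiableAt ℝ M p) (h0 : M p ≠ 0) (v : V) :
    fderiv ℝ (fun q => N q / M q) p v =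
      (fderiv ℝ N p v * M p - N p * fderiv ℝ M p v) / M p ^ 2 := by
  have h := (hasDerivAt_line_zero hN v).div (hasDerivAt_line_zero hM v) (by simpa using h0)
  have hd : DifferentiableAt ℝ (fun q => N q / M q) p := by
    simpa only [div_eq_mul_inv] using hN.fun_mul (hM.fun_inv h0)
  have := (hasDerivAt_line_zero hd v).unique h
  simpa using this

/-! ### The prolongation of a transformation that maps an equation to another one -/

namespace PointTransformation

variable (Φ : PointTransformation Base)

theorem smooth_T : ContDiffOn ℝ ∞ Φ.T Φ.source := contDiff_fst.comp_contDiffOn Φ.smooth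

theorem smooth_X : ContDiffOn ℝ ∞ Φ.X Φ.source :=
  contDiff_fst.comp_contDiffOn (contDiff_snd.comp_contDiffOn Φ.smooth)

theorem smooth_U : ContDiffOn ℝ ∞ Φ.U Φ.source :=
  contDiff_snd.comp_contDiffOn (contDiff_snd.comp_contDiffOn Φ.smooth)

theorem fderiv_toFun_apply {p : Base} (hp : p ∈ Φ.source) (v : Base) :
    fderiv ℝ Φ.toFun p v = (fderiv ℝ Φ.T p v, fderiv ℝ Φ.X p v, fderiv ℝ Φ.U p v) := by
  have hT := differentiableAt_of_smooth Φ.isOpen_source Φ.smooth_T hp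
  have hX := differentiableAt_of_smooth Φ.isOpen_source Φ.smooth_X hp
  have hU := differentiableAt_of_smooth Φ.isOpen_source Φ.smooth_U hp
  have h : HasFDerivAt Φ.toFun
      ((fderiv ℝ Φ.T p).prod ((fderiv ℝ Φ.X p).prod (fderiv ℝ Φ.U p))) p :=
    hT.hasFDerivAt.prodMk (hX.hasFDerivAt.prodMk hU.hasFDerivAt)
  rw [h.fderiv]
  rfl

/-- The Jacobian determinant. -/
noncomputable def jacobian (p : Base) : ℝ :=
  dirDeriv et Φ.T p *
      (dirDeriv ex Φ.X p * dirDeriv eu Φ.U p - dirDeriv eu Φ.X p * dirDeriv ex Φ.U p)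
  - dirDeriv ex Φ.T p *
      (dirDeriv et Φ.X p * dirDeriv eu Φ.U p - dirDeriv eu Φ.X p * dirDeriv et Φ.U p)
  + dirDeriv eu Φ.T p *
      (dirDeriv et Φ.X p * dirDeriv ex Φ.U p - dirDeriv ex Φ.X p * dirDeriv et Φ.U p)

theorem jacobian_ne_zero {p : Base} (hp : p ∈ Φ.source) : Φ.jacobian p ≠ 0 := by
  have hs := (Φ.nondegenerate p hp).surjective
  obtain ⟨⟨a₁, a₂, a₃⟩, ha⟩ := hs (1, 0, 0)
  obtain ⟨⟨b₁, b₂, b₃⟩, hb⟩ := hs (0, 1, 0)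
  obtain ⟨⟨c₁, c₂, c₃⟩, hc⟩ := hs (0, 0, 1)
  simp only [Φ.fderiv_toFun_apply hp, fderiv_base_apply, Prod.mk.injEq] at ha hb hc
  obtain ⟨ha1, ha2, ha3⟩ := ha
  obtain ⟨hb1, hb2, hb3⟩ := hb
  obtain ⟨hc1, hc2, hc3⟩ := hc
  -- Preimages of the basis vectors form the rows of a left inverse of the transposed Jacobian
  -- matrix.
  have hM : !![a₁, a₂, a₃; b₁, b₂, b₃; c₁, c₂, c₃] *
      !![dirDeriv et Φ.T p, dirDeriv et Φ.X p, dirDeriv et Φ.U p;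
         dirDeriv ex Φ.T p, dirDeriv ex Φ.X p, dirDeriv ex Φ.U p;
         dirDeriv eu Φ.T p, dirDeriv eu Φ.X p, dirDeriv eu Φ.U p] = 1 := by
    ext i k
    fin_cases i <;> fin_cases k <;>
      simp [Matrix.mul_apply, Fin.sum_univ_three, *]
  have hd := congrArg Matrix.det hM
  rw [Matrix.det_mul, Matrix.det_one] at hd
  have h0 := right_ne_zero_of_mul_eq_one hd
  rw [Matrix.det_fin_three] at h0
  intro hJ
  apply h0
  simp [jacobian] at hJ ⊢
  linarith

theorem differentiableAt_totalJacobian {j : Jet1} (hj : j.base ∈ Φ.source) :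
    DifferentiableAt ℝ Φ.totalJacobian j := by
  have h1 := differentiableAt_totalDt0 Φ.isOpen_source Φ.smooth_T hj
  have h2 := differentiableAt_totalDx0 Φ.isOpen_source Φ.smooth_T hj
  have h3 := differentiableAt_totalDt0 Φ.isOpen_source Φ.smooth_X hj
  have h4 := differentiableAt_totalDx0 Φ.isOpen_source Φ.smooth_X hj
  exact (h1.fun_mul h4).fun_sub (h2.fun_mul h3)

theorem differentiableAt_newUx {j : Jet1} (hj : j.base ∈ Φ.source) (hJ : Φ.totalJacobian j ≠ 0) :
    DifferentiableAt ℝ Φ.newUx j := by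
  have h1 := differentiableAt_totalDt0 Φ.isOpen_source Φ.smooth_T hj
  have h2 := differentiableAt_totalDx0 Φ.isOpen_source Φ.smooth_T hj
  have h3 := differentiableAt_totalDt0 Φ.isOpen_source Φ.smooth_U hj
  have h4 := differentiableAt_totalDx0 Φ.isOpen_source Φ.smooth_U hj
  have h5 : Φ.newUx = fun j => (totalDt0 Φ.T j * totalDx0 Φ.U j - totalDx0 Φ.T j * totalDt0 Φ.U j)
      * (Φ.totalJacobian j)⁻¹ := by
    ext j
    rw [newUx, div_eq_mul_inv]
  rw [h5]
  exact ((h1.fun_mul h4).fun_sub (h2.fun_mul h3)).fun_mul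
    ((Φ.differentiableAt_totalJacobian hj).fun_inv hJ)

/-- The derivative of the transformed `u_x` with respect to `u_t`. -/
theorem fderiv_newUx_ut {j : Jet1} (hj : j.base ∈ Φ.source) (hJ : Φ.totalJacobian j ≠ 0) :
    fderiv ℝ Φ.newUx j (0, 0, 0, 1, 0) =
      -(totalDx0 Φ.T j * Φ.jacobian j.base) / Φ.totalJacobian j ^ 2 := by
  have h1 := hasDerivAt_line_zero (Φ.differentiableAt_newUx hj hJ) (0, 0, 0, 1, 0)
  -- Along the u_t-axis the base point and all D_x F are fixed and every D_t F is affine, so the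
  -- derivative is that of a quotient of affine functions of one variable.
  have hb : ∀ s : ℝ, (j + s • ((0, 0, 0, 1, 0) : Jet1)).base = j.base := by
    intro s
    simp [Jet1.base]
  have hx : ∀ (F : Base → ℝ) (s : ℝ),
      totalDx0 F (j + s • ((0, 0, 0, 1, 0) : Jet1)) = totalDx0 F j := by
    intro F s
    rw [totalDx0_eq, totalDx0_eq, hb]
    simp
  have ht : ∀ (F : Base → ℝ) (s : ℝ), totalDt0 F (j + s • ((0, 0, 0, 1, 0) : Jet1)) =
      totalDt0 F j + s * dirDeriv eu F j.base := by
    intro F s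
    rw [totalDt0_eq, totalDt0_eq, hb]
    simp
    ring
  have hl : ∀ k l : ℝ, HasDerivAt (fun s : ℝ => k + s * l) l 0 := by
    intro k l
    simpa using ((hasDerivAt_id' (0 : ℝ)).mul_const l).const_add k
  have h2 := (((hl (totalDt0 Φ.T j) (dirDeriv eu Φ.T j.base)).mul_const (totalDx0 Φ.U j)).fun_sub
    ((hl (totalDt0 Φ.U j) (dirDeriv eu Φ.U j.base)).const_mul (totalDx0 Φ.T j))).fun_div
    (((hl (totalDt0 Φ.T j) (dirDeriv eu Φ.T j.base)).mul_const (totalDx0 Φ.X j)).fun_sub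
    ((hl (totalDt0 Φ.X j) (dirDeriv eu Φ.X j.base)).const_mul (totalDx0 Φ.T j)))
    (by simpa [totalJacobian] using hJ)
  have h3 : (fun s : ℝ => Φ.newUx (j + s • ((0, 0, 0, 1, 0) : Jet1))) = _ :=
    funext fun s => by
      rw [newUx, totalJacobian, ht, ht, ht, hx, hx, hx]
  rw [h3] at h1
  rw [h1.unique h2]
  -- The numerator is -D_x T times the determinant formed by D_t, D_x, ∂_u of T, X, U; row
  -- operations turn this determinant into the Jacobian.
  simp only [zero_mul, add_zero, totalJacobian]
  congr 1
  simp only [totalDt0_eq, totalDx0_eq, jacobian]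
  ring

/-- Over every point of the domain there are two first-order jets that differ in `u_x` only and to
which the transformation can be prolonged. -/
theorem exists_totalJacobian_ne_zero {p : Base} (hp : p ∈ Φ.source) :
    ∃ ut ux ux' : ℝ, ux ≠ ux' ∧ Φ.totalJacobian (p.1, p.2.1, p.2.2, ut, ux) ≠ 0 ∧
      Φ.totalJacobian (p.1, p.2.1, p.2.2, ut, ux') ≠ 0 := by
  have hJ := Φ.jacobian_ne_zero hp
  obtain ⟨t, x, u⟩ := p
  set c₀ := dirDeriv et Φ.T (t, x, u) * dirDeriv ex Φ.X (t, x, u) -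
    dirDeriv ex Φ.T (t, x, u) * dirDeriv et Φ.X (t, x, u) with hc₀
  set c₁ := dirDeriv eu Φ.T (t, x, u) * dirDeriv ex Φ.X (t, x, u) -
    dirDeriv ex Φ.T (t, x, u) * dirDeriv eu Φ.X (t, x, u) with hc₁
  set c₂ := dirDeriv et Φ.T (t, x, u) * dirDeriv eu Φ.X (t, x, u) -
    dirDeriv eu Φ.T (t, x, u) * dirDeriv et Φ.X (t, x, u) with hc₂
  have hj : ∀ ut ux : ℝ, Φ.totalJacobian (t, x, u, ut, ux) = c₀ + ut * c₁ + ux * c₂ := by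
    intro ut ux
    simp only [totalJacobian, totalDt0_eq, totalDx0_eq, Jet1.base, hc₀, hc₁, hc₂]
    ring
  simp only [hj]
  by_cases h₂ : c₂ = 0
  · have : c₀ ≠ 0 ∨ c₁ ≠ 0 := by
      by_contra! h
      apply hJ
      -- Expansion of the Jacobian along U: the three coefficients of the total Jacobian cannot
      -- vanish together.
      have : Φ.jacobian (t, x, u) = c₀ * dirDeriv eu Φ.U (t, x, u) - c₁ * dirDeriv et Φ.U (t, x, u)
          - c₂ * dirDeriv ex Φ.U (t, x, u) := by
        simp only [jacobian, hc₀, hc₁, hc₂]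
        ring
      rw [this, h.1, h.2, h₂]
      ring
    by_cases h₀ : c₀ = 0
    · refine ⟨1, 0, 1, by norm_num, ?_, ?_⟩ <;> simpa [h₀, h₂] using this
    · refine ⟨0, 0, 1, by norm_num, ?_, ?_⟩ <;> simpa [h₂] using h₀
  -- These values of u_x make the total Jacobian equal to 1 and 2.
  · refine ⟨0, (1 - c₀) / c₂, (2 - c₀) / c₂, ?_, ?_, ?_⟩
    · intro h
      field_simp at h
      linarith
    · field_simp
      norm_num
    · field_simp
      norm_num

/-- The variable u_tt enters only through D_t of ũ_x̃, multiplied by ∂ũ_x̃/∂u_t; one factor D_x T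
comes from this derivative, the other from the operator D_x̃. -/
theorem newDx_newUx_utt {j : Jet2} (hj : j.toJet1.base ∈ Φ.source)
    (hJ : Φ.totalJacobian j.toJet1 ≠ 0) (s : ℝ) :
    Φ.newDx Φ.newUx { j with utt := j.utt + s } = Φ.newDx Φ.newUx j +
      s * (totalDx0 Φ.T j.toJet1 ^ 2 * Φ.jacobian j.toJet1.base / Φ.totalJacobian j.toJet1 ^ 3) := by
  have h1 : ({ j with utt := j.utt + s } : Jet2).toJet1 = j.toJet1 := rfl
  have h2 : totalDx1 Φ.newUx { j with utt := j.utt + s } = totalDx1 Φ.newUx j := rfl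
  have h3 : totalDt1 Φ.newUx { j with utt := j.utt + s } = totalDt1 Φ.newUx j +
      s * fderiv ℝ Φ.newUx j.toJet1 (0, 0, 0, 1, 0) := by
    simp only [totalDt1, h1]
    rw [← smul_eq_mul, ← map_smul, ← map_add]
    simp
  rw [newDx, newDx, h1, h2, h3, Φ.fderiv_newUx_ut hj hJ]
  field_simp
  ring

end PointTransformation

section Maps

variable {E E' : Equation} {Φ : PointTransformation Base}

/-- The source of all determining equations: u_tt, u_tx and u_x are unrestricted by `E`. -/
theorem MapsEquation.prolong_eq (h : MapsEquation Φ E E') {t x u ut ux utt utx uxx : ℝ}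
    (hp : (t, x, u) ∈ Φ.source) (hJ : Φ.totalJacobian (t, x, u, ut, ux) ≠ 0)
    (hE : ut = E.a t ^ 2 * uxx + E.b t * u - E.c t * u ^ 3) :
    Φ.newUt (t, x, u, ut, ux) = E'.a (Φ.T (t, x, u)) ^ 2 *
        Φ.newDx Φ.newUx ⟨t, x, u, ut, ux, utt, utx, uxx⟩ +
      E'.b (Φ.T (t, x, u)) * Φ.U (t, x, u) - E'.c (Φ.T (t, x, u)) * Φ.U (t, x, u) ^ 3 :=
  ((h.2 ⟨t, x, u, ut, ux, utt, utx, uxx⟩ hp hJ).1 ⟨(h.1 _ hp).1, hE⟩).2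

/-- Neither `E` nor ũ_t̃ involves u_tt, so the u_tt-slope of ũ_x̃x̃ must vanish, while the Jacobian
does not. -/
theorem MapsEquation.totalDx0_T_eq_zero (h : MapsEquation Φ E E') {t x u ut ux : ℝ}
    (hp : (t, x, u) ∈ Φ.source) (hJ : Φ.totalJacobian (t, x, u, ut, ux) ≠ 0) :
    totalDx0 Φ.T (t, x, u, ut, ux) = 0 := by
  have ha := E.a_ne_zero t (h.1 _ hp).1
  have ha' := E'.a_ne_zero _ (h.1 _ hp).2
  -- Since a ≠ 0, every first-order jet over the domain lifts to the manifold of `E`.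
  set uxx := (ut - E.b t * u + E.c t * u ^ 3) / E.a t ^ 2 with huxx
  have hE : ut = E.a t ^ 2 * uxx + E.b t * u - E.c t * u ^ 3 := by
    rw [huxx]
    field_simp
    ring
  have h0 := h.prolong_eq (utt := 0) (utx := 0) hp hJ hE
  have h1 := h.prolong_eq (utt := 0 + 1) (utx := 0) hp hJ hE
  have h2 := Φ.newDx_newUx_utt (j := ⟨t, x, u, ut, ux, 0, 0, uxx⟩) hp hJ 1
  rw [h0] at h1
  have h3 : Φ.newDx Φ.newUx ⟨t, x, u, ut, ux, 0, 0, uxx⟩ =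
      Φ.newDx Φ.newUx ⟨t, x, u, ut, ux, 0 + 1, 0, uxx⟩ := by
    have h4 : E'.a (Φ.T (t, x, u)) ^ 2 * Φ.newDx Φ.newUx ⟨t, x, u, ut, ux, 0, 0, uxx⟩ =
      E'.a (Φ.T (t, x, u)) ^ 2 * Φ.newDx Φ.newUx ⟨t, x, u, ut, ux, 0 + 1, 0, uxx⟩ := by
      linarith
    exact mul_left_cancel₀ (pow_ne_zero 2 ha') h4
  simp only at h2
  rw [← h3] at h2
  have h5 := Φ.jacobian_ne_zero hp
  simp only [left_eq_add, one_mul, div_eq_zero_iff, mul_eq_zero] at h2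
  have h6 : Φ.jacobian (Jet2.toJet1 ⟨t, x, u, ut, ux, 0, 0, uxx⟩).base ≠ 0 := h5
  have h7 : Φ.totalJacobian (Jet2.toJet1 ⟨t, x, u, ut, ux, 0, 0, uxx⟩) ≠ 0 := hJ
  have h8 : totalDx0 Φ.T (Jet2.toJet1 ⟨t, x, u, ut, ux, 0, 0, uxx⟩) = 0 := by
    simpa [h6, h7] using h2
  exact h8

theorem MapsEquation.dirDeriv_T (h : MapsEquation Φ E E') {p : Base} (hp : p ∈ Φ.source) :
    dirDeriv ex Φ.T p = 0 ∧ dirDeriv eu Φ.T p = 0 := by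
  obtain ⟨ut, ux, ux', hne, h1, h2⟩ := Φ.exists_totalJacobian_ne_zero hp
  obtain ⟨t, x, u⟩ := p
  have h3 := h.totalDx0_T_eq_zero hp h1
  have h4 := h.totalDx0_T_eq_zero hp h2
  rw [totalDx0_eq] at h3 h4
  simp only [Jet1.base] at h3 h4
  -- T_x + u_x T_u vanishes for two values of u_x.
  have h5 : (ux - ux') * dirDeriv eu Φ.T (t, x, u) = 0 := by linear_combination h3 - h4
  have h6 : dirDeriv eu Φ.T (t, x, u) = 0 := by
    simpa [sub_ne_zero.2 hne] using h5
  rw [h6] at h3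
  exact ⟨by simpa using h3, h6⟩

end Maps

/-! ### Transformations whose time component depends on time only -/

namespace PointTransformation

variable {Φ : PointTransformation Base}

/-- The prolongation to `u_t` in the case `T_x = T_u = 0`. -/
theorem newUt_of_T {j : Jet1} (hT : dirDeriv ex Φ.T j.base = 0 ∧ dirDeriv eu Φ.T j.base = 0) :
    Φ.newUt j = (totalDx0 Φ.X j * totalDt0 Φ.U j - totalDt0 Φ.X j * totalDx0 Φ.U j) /
      (dirDeriv et Φ.T j.base * totalDx0 Φ.X j) := by
  have h1 : totalDt0 Φ.T j = dirDeriv et Φ.T j.base := by rw [totalDt0_eq, hT.2]; ring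
  have h2 : totalDx0 Φ.T j = 0 := by rw [totalDx0_eq, hT.1, hT.2]; ring
  rw [newUt, totalJacobian, h1, h2]
  ring

theorem totalJacobian_of_T {j : Jet1}
    (hT : dirDeriv ex Φ.T j.base = 0 ∧ dirDeriv eu Φ.T j.base = 0) :
    Φ.totalJacobian j = dirDeriv et Φ.T j.base * totalDx0 Φ.X j := by
  have h1 : totalDt0 Φ.T j = dirDeriv et Φ.T j.base := by rw [totalDt0_eq, hT.2]; ring
  have h2 : totalDx0 Φ.T j = 0 := by rw [totalDx0_eq, hT.1, hT.2]; ring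
  rw [totalJacobian, h1, h2]
  ring

theorem dirDeriv_T_ne_zero {p : Base} (hp : p ∈ Φ.source)
    (hT : dirDeriv ex Φ.T p = 0 ∧ dirDeriv eu Φ.T p = 0) : dirDeriv et Φ.T p ≠ 0 := by
  intro h
  apply Φ.jacobian_ne_zero hp
  simp [jacobian, h, hT.1, hT.2]

/-- The prolongation to `u_xx` in the case `T_x = T_u = 0`. -/
theorem newDx_newUx_of_T (hT : ∀ p ∈ Φ.source, dirDeriv ex Φ.T p = 0 ∧ dirDeriv eu Φ.T p = 0)
    {j : Jet2} (hj : j.toJet1.base ∈ Φ.source) (hX : totalDx0 Φ.X j.toJet1 ≠ 0) :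
    Φ.newDx Φ.newUx j =
      (totalDx1 (totalDx0 Φ.U) j * totalDx0 Φ.X j.toJet1 -
        totalDx0 Φ.U j.toJet1 * totalDx1 (totalDx0 Φ.X) j) / totalDx0 Φ.X j.toJet1 ^ 3 := by
  have hTt := dirDeriv_T_ne_zero hj (hT _ hj)
  have h1 : totalDt0 Φ.T j.toJet1 = dirDeriv et Φ.T j.toJet1.base := by
    rw [totalDt0_eq, (hT _ hj).2]; ring
  have h2 : totalDx0 Φ.T j.toJet1 = 0 := by rw [totalDx0_eq, (hT _ hj).1, (hT _ hj).2]; ring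
  have hev : Φ.newUx =ᶠ[𝓝 j.toJet1] fun k => totalDx0 Φ.U k / totalDx0 Φ.X k := by
    have hc : ContinuousAt Jet1.base j.toJet1 := baseL.continuous.continuousAt
    filter_upwards [hc.eventually_mem (Φ.isOpen_source.mem_nhds hj)] with k hk
    have hk1 : totalDt0 Φ.T k = dirDeriv et Φ.T k.base := by rw [totalDt0_eq, (hT _ hk).2]; ring
    have hk2 : totalDx0 Φ.T k = 0 := by rw [totalDx0_eq, (hT _ hk).1, (hT _ hk).2]; ring
    rw [newUx, totalJacobian_of_T (hT _ hk), hk1, hk2, zero_mul, sub_zero,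
      mul_div_mul_left _ _ (dirDeriv_T_ne_zero hk (hT _ hk))]
  have h3 : totalDx1 Φ.newUx j =
      (totalDx1 (totalDx0 Φ.U) j * totalDx0 Φ.X j.toJet1 -
        totalDx0 Φ.U j.toJet1 * totalDx1 (totalDx0 Φ.X) j) / totalDx0 Φ.X j.toJet1 ^ 2 := by
    rw [totalDx1, hev.fderiv_eq, fderiv_div_apply
      (differentiableAt_totalDx0 Φ.isOpen_source Φ.smooth_U hj)
      (differentiableAt_totalDx0 Φ.isOpen_source Φ.smooth_X hj) hX]
    rfl
  rw [newDx, h3, totalJacobian_of_T (hT _ hj), h1, h2]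
  field_simp
  ring

end PointTransformation

/-! ### The determining equations -/

section Maps

variable {E E' : Equation} {Φ : PointTransformation Base}

theorem MapsEquation.dirDeriv_et_T_ne_zero (h : MapsEquation Φ E E') {p : Base}
    (hp : p ∈ Φ.source) : dirDeriv et Φ.T p ≠ 0 :=
  PointTransformation.dirDeriv_T_ne_zero hp (h.dirDeriv_T hp)

/-- The transformed equation with u_t eliminated by `E`; u_x and u_xx remain free where D_x X ≠ 0.
-/
theorem MapsEquation.eq_of_T (h : MapsEquation Φ E E') {t x u : ℝ} (ux uxx : ℝ)
    (hp : (t, x, u) ∈ Φ.source)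
    (hX : dirDeriv ex Φ.X (t, x, u) + ux * dirDeriv eu Φ.X (t, x, u) ≠ 0) :
    ((dirDeriv ex Φ.X (t, x, u) + ux * dirDeriv eu Φ.X (t, x, u)) *
        (dirDeriv et Φ.U (t, x, u) + (E.a t ^ 2 * uxx + E.b t * u - E.c t * u ^ 3) *
          dirDeriv eu Φ.U (t, x, u)) -
      (dirDeriv et Φ.X (t, x, u) + (E.a t ^ 2 * uxx + E.b t * u - E.c t * u ^ 3) *
          dirDeriv eu Φ.X (t, x, u)) *
        (dirDeriv ex Φ.U (t, x, u) + ux * dirDeriv eu Φ.U (t, x, u))) /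
      (dirDeriv et Φ.T (t, x, u) *
        (dirDeriv ex Φ.X (t, x, u) + ux * dirDeriv eu Φ.X (t, x, u))) =
    E'.a (Φ.T (t, x, u)) ^ 2 *
      (((dirDeriv ex (dirDeriv ex Φ.U) (t, x, u) + 2 * ux * dirDeriv ex (dirDeriv eu Φ.U) (t, x, u)
        + ux ^ 2 * dirDeriv eu (dirDeriv eu Φ.U) (t, x, u) + uxx * dirDeriv eu Φ.U (t, x, u)) *
        (dirDeriv ex Φ.X (t, x, u) + ux * dirDeriv eu Φ.X (t, x, u)) -
       (dirDeriv ex Φ.U (t, x, u) + ux * dirDeriv eu Φ.U (t, x, u)) *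
        (dirDeriv ex (dirDeriv ex Φ.X) (t, x, u) + 2 * ux * dirDeriv ex (dirDeriv eu Φ.X) (t, x, u)
        + ux ^ 2 * dirDeriv eu (dirDeriv eu Φ.X) (t, x, u) +
        uxx * dirDeriv eu Φ.X (t, x, u))) /
        (dirDeriv ex Φ.X (t, x, u) + ux * dirDeriv eu Φ.X (t, x, u)) ^ 3) +
      E'.b (Φ.T (t, x, u)) * Φ.U (t, x, u) - E'.c (Φ.T (t, x, u)) * Φ.U (t, x, u) ^ 3 := by
  set ut := E.a t ^ 2 * uxx + E.b t * u - E.c t * u ^ 3 with hut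
  have hT : dirDeriv ex Φ.T (Jet1.base (t, x, u, ut, ux)) = 0 ∧
    dirDeriv eu Φ.T (Jet1.base (t, x, u, ut, ux)) = 0 := h.dirDeriv_T hp
  have hX' : totalDx0 Φ.X (t, x, u, ut, ux) ≠ 0 := by
    rw [totalDx0_eq]
    exact hX
  have hJ : Φ.totalJacobian (t, x, u, ut, ux) ≠ 0 := by
    rw [PointTransformation.totalJacobian_of_T hT]
    exact mul_ne_zero (h.dirDeriv_et_T_ne_zero hp) hX'
  have h1 := h.prolong_eq (utt := 0) (utx := 0) hp hJ hut
  have hp' : (Jet2.toJet1 ⟨t, x, u, ut, ux, 0, 0, uxx⟩).base ∈ Φ.source := hp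
  rw [PointTransformation.newUt_of_T hT, PointTransformation.newDx_newUx_of_T
    (j := ⟨t, x, u, ut, ux, 0, 0, uxx⟩) (fun q hq => h.dirDeriv_T hq) hp' hX',
    totalDx1_totalDx0 Φ.isOpen_source Φ.smooth_U hp',
    totalDx1_totalDx0 Φ.isOpen_source Φ.smooth_X hp'] at h1
  simpa only [totalDx0_eq, totalDt0_eq, Jet2.toJet1, Jet1.base] using h1

/-- Comparison of the coefficients of u_xx, read off from the values 0 and 1. Both carry the factor
X_x U_u - X_u U_x, which is nonzero because T_t times it is the Jacobian. -/
theorem MapsEquation.sq_totalDx0_X (h : MapsEquation Φ E E') {t x u : ℝ} (ux : ℝ)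
    (hp : (t, x, u) ∈ Φ.source)
    (hX : dirDeriv ex Φ.X (t, x, u) + ux * dirDeriv eu Φ.X (t, x, u) ≠ 0) :
    E.a t ^ 2 * (dirDeriv ex Φ.X (t, x, u) + ux * dirDeriv eu Φ.X (t, x, u)) ^ 2 =
      E'.a (Φ.T (t, x, u)) ^ 2 * dirDeriv et Φ.T (t, x, u) := by
  have h0 := h.eq_of_T ux 0 hp hX
  have h1 := h.eq_of_T ux 1 hp hX
  have hT := h.dirDeriv_T hp
  have hTt := h.dirDeriv_et_T_ne_zero hp
  have hJ := Φ.jacobian_ne_zero hp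
  have hD : dirDeriv ex Φ.X (t, x, u) * dirDeriv eu Φ.U (t, x, u) -
      dirDeriv eu Φ.X (t, x, u) * dirDeriv ex Φ.U (t, x, u) ≠ 0 := by
    intro h0
    apply hJ
    simp [PointTransformation.jacobian, hT.1, hT.2, h0]
  generalize dirDeriv ex Φ.X (t, x, u) = Xx at *
  generalize dirDeriv eu Φ.X (t, x, u) = Xu at *
  generalize dirDeriv et Φ.X (t, x, u) = Xt at *
  generalize dirDeriv ex Φ.U (t, x, u) = Ux at *
  generalize dirDeriv eu Φ.U (t, x, u) = Uu at *
  generalize dirDeriv et Φ.U (t, x, u) = Ut at *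
  generalize dirDeriv et Φ.T (t, x, u) = Tt at *
  generalize E'.a (Φ.T (t, x, u)) = a' at *
  have hW : Xx * Uu - Xu * Ux = (Xx + ux * Xu) * Uu - Xu * (Ux + ux * Uu) := by ring
  generalize Xx + ux * Xu = W at *
  have h2 : E.a t ^ 2 * (W * Uu - Xu * (Ux + ux * Uu)) / (Tt * W) =
      a' ^ 2 * (W * Uu - Xu * (Ux + ux * Uu)) / W ^ 3 := by
    linear_combination h1 - h0
  rw [hW] at hD
  generalize W * Uu - Xu * (Ux + ux * Uu) = D at *
  field_simp at h2
  linarith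

theorem MapsEquation.dirDeriv_eu_X (h : MapsEquation Φ E E') {p : Base} (hp : p ∈ Φ.source) :
    dirDeriv eu Φ.X p = 0 := by
  obtain ⟨t, x, u⟩ := p
  by_contra hXu
  -- If X_u ≠ 0, then D_x X takes the values 1 and 2 over the same point, although a² (D_x X)² does
  -- not depend on u_x.
  have h1 := h.sq_totalDx0_X ((1 - dirDeriv ex Φ.X (t, x, u)) / dirDeriv eu Φ.X (t, x, u)) hp
    (by field_simp; norm_num)
  have h2 := h.sq_totalDx0_X ((2 - dirDeriv ex Φ.X (t, x, u)) / dirDeriv eu Φ.X (t, x, u)) hp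
    (by field_simp; norm_num)
  rw [← h1] at h2
  have h3 : ∀ k : ℝ, dirDeriv ex Φ.X (t, x, u) + (k - dirDeriv ex Φ.X (t, x, u)) /
      dirDeriv eu Φ.X (t, x, u) * dirDeriv eu Φ.X (t, x, u) = k := by
    intro k
    field_simp
    ring
  rw [h3, h3] at h2
  have := E.a_ne_zero t (h.1 _ hp).1
  have h4 : E.a t ^ 2 = 0 := by linarith
  exact this (by simpa using h4)

theorem MapsEquation.jacobian_eq (h : MapsEquation Φ E E') {p : Base} (hp : p ∈ Φ.source) :
    dirDeriv et Φ.T p * dirDeriv ex Φ.X p * dirDeriv eu Φ.U p ≠ 0 := by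
  have hJ := Φ.jacobian_ne_zero hp
  simpa [PointTransformation.jacobian, (h.dirDeriv_T hp).1, (h.dirDeriv_T hp).2,
    h.dirDeriv_eu_X hp, and_assoc] using hJ

theorem MapsEquation.sq_dirDeriv_ex_X (h : MapsEquation Φ E E') {p : Base} (hp : p ∈ Φ.source) :
    E.a p.1 ^ 2 * dirDeriv ex Φ.X p ^ 2 = E'.a (Φ.T p) ^ 2 * dirDeriv et Φ.T p := by
  obtain ⟨t, x, u⟩ := p
  have h1 := h.jacobian_eq hp
  have h2 := h.sq_totalDx0_X 0 hp (by
    intro h0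
    apply h1
    rw [zero_mul, add_zero] at h0
    rw [h0]
    ring)
  simpa using h2

/-- Moving in x or u freezes every coefficient of the determining equations that depends on t and T
only, which allows splitting along such lines. -/
theorem MapsEquation.eventually_T (h : MapsEquation Φ E E') {p v : Base} (hp : p ∈ Φ.source)
    (hv : v = ex ∨ v = eu) :
    ∀ᶠ s : ℝ in 𝓝 0, p + s • v ∈ Φ.source ∧ (p + s • v).1 = p.1 ∧ Φ.T (p + s • v) = Φ.T p ∧
      dirDeriv et Φ.T (p + s • v) = dirDeriv et Φ.T p := by
  have h0 : ∀ q ∈ Φ.source, dirDeriv v Φ.T q = 0 := by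
    intro q hq
    rcases hv with rfl | rfl
    exacts [(h.dirDeriv_T hq).1, (h.dirDeriv_T hq).2]
  have h1 : ∀ q ∈ Φ.source, dirDeriv v (dirDeriv et Φ.T) q = 0 := by
    intro q hq
    rw [dirDeriv_comm Φ.isOpen_source Φ.smooth_T hq]
    exact dirDeriv_eq_zero Φ.isOpen_source h0 hq
  have h2 : v.1 = 0 := by rcases hv with rfl | rfl <;> rfl
  filter_upwards [eventually_line_mem Φ.isOpen_source hp v,
    eventually_line_eq Φ.isOpen_source Φ.smooth_T h0 hp,
    eventually_line_eq Φ.isOpen_source (smooth_dirDeriv Φ.isOpen_source Φ.smooth_T et) h1 hp]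
    with s hs1 hs2 hs3
  exact ⟨hs1, by simp [h2], hs2, hs3⟩

theorem MapsEquation.dirDeriv_ex_ex_X (h : MapsEquation Φ E E') {p : Base} (hp : p ∈ Φ.source) :
    dirDeriv ex (dirDeriv ex Φ.X) p = 0 := by
  have hX : dirDeriv ex Φ.X p ≠ 0 := right_ne_zero_of_mul (left_ne_zero_of_mul (h.jacobian_eq hp))
  refine dirDeriv_eq_zero_of_sq_eventually_const Φ.isOpen_source
    (smooth_dirDeriv Φ.isOpen_source Φ.smooth_X ex) hp hX ?_
  filter_upwards [h.eventually_T hp (Or.inl rfl)] with s hs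
  have h1 := h.sq_dirDeriv_ex_X hs.1
  rw [hs.2.1, hs.2.2.1, hs.2.2.2, ← h.sq_dirDeriv_ex_X hp] at h1
  exact mul_left_cancel₀ (pow_ne_zero 2 (E.a_ne_zero _ (h.1 _ hp).1)) h1

/-- The determining equations that remain for `X` and `U`. -/
theorem MapsEquation.determining (h : MapsEquation Φ E E') {p : Base} (hp : p ∈ Φ.source) :
    dirDeriv eu (dirDeriv eu Φ.U) p = 0 ∧
    -(dirDeriv et Φ.X p * dirDeriv eu Φ.U p) =
      2 * E.a p.1 ^ 2 * dirDeriv ex Φ.X p * dirDeriv ex (dirDeriv eu Φ.U) p ∧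
    dirDeriv et Φ.U p + (E.b p.1 * p.2.2 - E.c p.1 * p.2.2 ^ 3) * dirDeriv eu Φ.U p -
        dirDeriv et Φ.X p / dirDeriv ex Φ.X p * dirDeriv ex Φ.U p =
      E.a p.1 ^ 2 * dirDeriv ex (dirDeriv ex Φ.U) p +
      dirDeriv et Φ.T p * (E'.b (Φ.T p) * Φ.U p - E'.c (Φ.T p) * Φ.U p ^ 3) := by
  have hXxx := h.dirDeriv_ex_ex_X hp
  have hXu := h.dirDeriv_eu_X hp
  have hXxu : dirDeriv ex (dirDeriv eu Φ.X) p = 0 :=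
    dirDeriv_eq_zero Φ.isOpen_source (fun q hq => h.dirDeriv_eu_X hq) hp
  have hXuu : dirDeriv eu (dirDeriv eu Φ.X) p = 0 :=
    dirDeriv_eq_zero Φ.isOpen_source (fun q hq => h.dirDeriv_eu_X hq) hp
  have hX : dirDeriv ex Φ.X p ≠ 0 := right_ne_zero_of_mul (left_ne_zero_of_mul (h.jacobian_eq hp))
  have hTt := h.dirDeriv_et_T_ne_zero hp
  have hsq := h.sq_dirDeriv_ex_X hp
  have ha := E.a_ne_zero _ (h.1 _ hp).1
  obtain ⟨t, x, u⟩ := p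
  have key : ∀ ux : ℝ, dirDeriv et Φ.U (t, x, u) + (E.b t * u - E.c t * u ^ 3) *
        dirDeriv eu Φ.U (t, x, u) - dirDeriv et Φ.X (t, x, u) / dirDeriv ex Φ.X (t, x, u) *
        (dirDeriv ex Φ.U (t, x, u) + ux * dirDeriv eu Φ.U (t, x, u)) =
      E.a t ^ 2 * (dirDeriv ex (dirDeriv ex Φ.U) (t, x, u) +
        2 * ux * dirDeriv ex (dirDeriv eu Φ.U) (t, x, u) +
        ux ^ 2 * dirDeriv eu (dirDeriv eu Φ.U) (t, x, u)) +
      dirDeriv et Φ.T (t, x, u) *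
        (E'.b (Φ.T (t, x, u)) * Φ.U (t, x, u) - E'.c (Φ.T (t, x, u)) * Φ.U (t, x, u) ^ 3) := by
    intro ux
    -- The u_xx-terms are already balanced by `hsq`, so u_xx = 0 loses nothing.
    have h1 := h.eq_of_T ux 0 hp (by simpa [hXu] using hX)
    simp only [hXxx, hXxu, hXuu, hXu, mul_zero, add_zero, zero_mul, sub_zero, zero_add] at h1
    generalize dirDeriv ex Φ.X (t, x, u) = Xx at *
    generalize dirDeriv et Φ.T (t, x, u) = Tt at *
    simp only at hsq
    have h2 : E'.a (Φ.T (t, x, u)) ^ 2 = E.a t ^ 2 * Xx ^ 2 / Tt := by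
      rw [hsq]
      field_simp
    rw [h2] at h1
    field_simp at h1 ⊢
    linear_combination h1
  -- A quadratic identity in u_x; the nodes 0, 1, -1 separate its coefficients.
  have k0 := key 0
  have k1 := key 1
  have k2 := key (-1)
  simp only
  have e1 : E.a t ^ 2 * dirDeriv eu (dirDeriv eu Φ.U) (t, x, u) = 0 := by
    linear_combination k0 - k1 / 2 - k2 / 2
  refine ⟨(mul_eq_zero.1 e1).resolve_left (pow_ne_zero 2 ha), ?_, ?_⟩
  · have e2 : -(dirDeriv et Φ.X (t, x, u) / dirDeriv ex Φ.X (t, x, u) *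
        dirDeriv eu Φ.U (t, x, u)) = 2 * E.a t ^ 2 * dirDeriv ex (dirDeriv eu Φ.U) (t, x, u) := by
      linear_combination k1 / 2 - k2 / 2
    field_simp at e2
    linear_combination e2
  · linear_combination k0

theorem cubic_coeff_eq_zero {k₀ k₁ k₂ k₃ : ℝ}
    (h : ∀ᶠ s : ℝ in 𝓝 0, k₀ + k₁ * s + k₂ * s ^ 2 + k₃ * s ^ 3 = 0) :
    k₀ = 0 ∧ k₁ = 0 ∧ k₂ = 0 ∧ k₃ = 0 := by
  obtain ⟨ε, hε, hb⟩ := Metric.eventually_nhds_iff.1 h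
  -- With d = ε/4 the nodes 0, ±d, 2d lie within distance ε of 0, and four values determine a cubic.
  have hk : ∀ c : ℝ, |c| ≤ 2 → k₀ + k₁ * (c * (ε / 4)) + k₂ * (c * (ε / 4)) ^ 2 +
      k₃ * (c * (ε / 4)) ^ 3 = 0 := by
    intro c hc
    apply hb
    rw [Real.dist_eq, sub_zero, abs_mul, abs_of_pos (by positivity : 0 < ε / 4)]
    nlinarith
  have h0 := hk 0 (by norm_num)
  have h1 := hk 1 (by norm_num)
  have h2 := hk (-1) (by norm_num)
  have h3 := hk 2 (by norm_num)
  have hd : ε / 4 ≠ 0 := by positivity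
  generalize ε / 4 = d at *
  have e0 : k₀ = 0 := by linarith
  have e2 : k₂ * d ^ 2 = 0 := by linear_combination h1 / 2 + h2 / 2 - h0
  have e3 : k₃ * d ^ 3 = 0 := by
    linear_combination (h3 - h1 + h2 - h0 - 4 * e2) / 6
  have e1 : k₁ * d = 0 := by linear_combination h1 - e0 - e2 - e3
  exact ⟨e0, by simpa [hd] using e1, by simpa [hd] using e2, by simpa [hd] using e3⟩

/-- U_uu = 0 makes the last determining equation a cubic in the shift s of u. The coefficient of s³
gives the relation for c; inserted into that of s², it leaves c U = c u U_u. The expansion is at p,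
since u = 0 need not occur in the domain. -/
theorem MapsEquation.U_eq (h : MapsEquation Φ E E') {p : Base} (hp : p ∈ Φ.source) :
    Φ.U p = p.2.2 * dirDeriv eu Φ.U p ∧
      E.c p.1 = dirDeriv et Φ.T p * E'.c (Φ.T p) * dirDeriv eu Φ.U p ^ 2 := by
  have hS := Φ.isOpen_source
  have hU := Φ.smooth_U
  have hUu := smooth_dirDeriv hS hU eu
  have hUt := smooth_dirDeriv hS hU et
  have hUx := smooth_dirDeriv hS hU ex
  have hUxx := smooth_dirDeriv hS hUx ex
  have h0 : ∀ q ∈ Φ.source, dirDeriv eu (dirDeriv eu Φ.U) q = 0 := fun q hq => (h.determining hq).1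
  -- Commuting derivatives: with U, also U_t, U_x and U_xx are affine in u.
  have hcomm : ∀ w : Base, ∀ q ∈ Φ.source, ∀ F : Base → ℝ, ContDiffOn ℝ ∞ F Φ.source →
      (∀ r ∈ Φ.source, dirDeriv eu (dirDeriv eu F) r = 0) →
      dirDeriv eu (dirDeriv eu (dirDeriv w F)) q = 0 := by
    intro w q hq F hF hF0
    rw [dirDeriv_congr hS (fun r hr => dirDeriv_comm hS hF hr) hq,
      dirDeriv_comm hS (smooth_dirDeriv hS hF eu) hq]
    exact dirDeriv_eq_zero hS hF0 hq
  have hconst : ∀ w : Base, ∀ q ∈ Φ.source, dirDeriv eu (dirDeriv w Φ.X) q = 0 := by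
    intro w q hq
    rw [dirDeriv_comm hS Φ.smooth_X hq]
    exact dirDeriv_eq_zero hS (fun r hr => h.dirDeriv_eu_X hr) hq
  have aU := eventually_line_affine hS hU h0 hp
  have aUu := eventually_line_eq hS hUu h0 hp
  have aUt := eventually_line_affine hS hUt (fun q hq => hcomm et q hq _ hU h0) hp
  have aUx := eventually_line_affine hS hUx (fun q hq => hcomm ex q hq _ hU h0) hp
  have aUxx := eventually_line_affine hS hUxx
    (fun q hq => hcomm ex q hq _ hUx fun r hr => hcomm ex r hr _ hU h0) hp
  have aXt := eventually_line_eq hS (smooth_dirDeriv hS Φ.smooth_X et) (hconst et) hp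
  have aXx := eventually_line_eq hS (smooth_dirDeriv hS Φ.smooth_X ex) (hconst ex) hp
  have hne : dirDeriv eu Φ.U p ≠ 0 := right_ne_zero_of_mul (h.jacobian_eq hp)
  have hc := E.c_ne_zero _ (h.1 _ hp).1
  have key : ∀ᶠ s : ℝ in 𝓝 0,
      (dirDeriv et Φ.U p + (E.b p.1 * p.2.2 - E.c p.1 * p.2.2 ^ 3) * dirDeriv eu Φ.U p -
        dirDeriv et Φ.X p / dirDeriv ex Φ.X p * dirDeriv ex Φ.U p -
        E.a p.1 ^ 2 * dirDeriv ex (dirDeriv ex Φ.U) p -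
        dirDeriv et Φ.T p * (E'.b (Φ.T p) * Φ.U p - E'.c (Φ.T p) * Φ.U p ^ 3)) +
      (dirDeriv eu (dirDeriv et Φ.U) p +
        (E.b p.1 - 3 * E.c p.1 * p.2.2 ^ 2) * dirDeriv eu Φ.U p -
        dirDeriv et Φ.X p / dirDeriv ex Φ.X p * dirDeriv eu (dirDeriv ex Φ.U) p -
        E.a p.1 ^ 2 * dirDeriv eu (dirDeriv ex (dirDeriv ex Φ.U)) p -
        dirDeriv et Φ.T p * (E'.b (Φ.T p) * dirDeriv eu Φ.U p -
          3 * E'.c (Φ.T p) * Φ.U p ^ 2 * dirDeriv eu Φ.U p)) * s +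
      (3 * dirDeriv et Φ.T p * E'.c (Φ.T p) * Φ.U p * dirDeriv eu Φ.U p ^ 2 -
        3 * E.c p.1 * p.2.2 * dirDeriv eu Φ.U p) * s ^ 2 +
      (dirDeriv et Φ.T p * E'.c (Φ.T p) * dirDeriv eu Φ.U p ^ 3 -
        E.c p.1 * dirDeriv eu Φ.U p) * s ^ 3 = 0 := by
    filter_upwards [aU, aUu, aUt, aUx, aUxx, aXt, aXx, h.eventually_T hp (Or.inr rfl)]
      with s s1 s2 s3 s4 s5 s6 s7 s8
    obtain ⟨hs, ht, hT, hTt⟩ := s8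
    have h1 := (h.determining hs).2.2
    have hu : (p + s • eu).2.2 = p.2.2 + s := by simp [eu]
    rw [s1, s2, s3, s4, s5, s6, s7, ht, hT, hTt, hu] at h1
    linear_combination h1
  obtain ⟨-, -, k2, k3⟩ := cubic_coeff_eq_zero key
  have e3 : E.c p.1 = dirDeriv et Φ.T p * E'.c (Φ.T p) * dirDeriv eu Φ.U p ^ 2 := by
    have : dirDeriv eu Φ.U p * E.c p.1 =
        dirDeriv eu Φ.U p * (dirDeriv et Φ.T p * E'.c (Φ.T p) * dirDeriv eu Φ.U p ^ 2) := by
      linear_combination -k3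
    exact mul_left_cancel₀ hne this
  refine ⟨?_, e3⟩
  have : E.c p.1 * Φ.U p = E.c p.1 * (p.2.2 * dirDeriv eu Φ.U p) := by
    linear_combination k2 / 3 + Φ.U p * e3
  exact mul_left_cancel₀ hc this

/-- In c = T_t c'(T) U_u² everything but U_u is constant along the x-axis. -/
theorem MapsEquation.dirDeriv_ex_eu_U (h : MapsEquation Φ E E') {p : Base} (hp : p ∈ Φ.source) :
    dirDeriv ex (dirDeriv eu Φ.U) p = 0 := by
  refine dirDeriv_eq_zero_of_sq_eventually_const Φ.isOpen_source
    (smooth_dirDeriv Φ.isOpen_source Φ.smooth_U eu) hp (right_ne_zero_of_mul (h.jacobian_eq hp)) ?_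
  filter_upwards [h.eventually_T hp (Or.inl rfl)] with s hs
  have h1 := (h.U_eq hs.1).2
  rw [hs.2.1, hs.2.2.1, hs.2.2.2, (h.U_eq hp).2] at h1
  exact (mul_left_cancel₀ (mul_ne_zero (h.dirDeriv_et_T_ne_zero hp)
    (E'.c_ne_zero _ (h.1 _ hp).2)) h1).symm

theorem MapsEquation.dirDeriv_et_X (h : MapsEquation Φ E E') {p : Base} (hp : p ∈ Φ.source) :
    dirDeriv et Φ.X p = 0 := by
  have h1 := (h.determining hp).2.1
  rw [h.dirDeriv_ex_eu_U hp, mul_zero, neg_eq_zero] at h1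
  exact (mul_eq_zero.1 h1).resolve_right (right_ne_zero_of_mul (h.jacobian_eq hp))

theorem eq_const_of_dirDeriv_eq_zero {S : Set Base} {F : Base → ℝ} (hS : IsOpen S)
    (hc : IsPreconnected S) (hF : ContDiffOn ℝ ∞ F S)
    (h : ∀ p ∈ S, dirDeriv et F p = 0 ∧ dirDeriv ex F p = 0 ∧ dirDeriv eu F p = 0) :
    ∃ k, ∀ p ∈ S, F p = k :=
  hS.exists_is_const_of_fderiv_eq_zero hc
    (fun _ hp => (differentiableAt_of_smooth hS hF hp).differentiableWithinAt)
    (fun p hp => fderiv_eq_zero_of_dirDeriv (h p hp).1 (h p hp).2.1 (h p hp).2.2)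

/-- The form of the component `X`. -/
theorem MapsEquation.exists_X_eq (h : MapsEquation Φ E E') (hc : IsPreconnected Φ.source) :
    ∃ δ₁ δ₂ : ℝ, (∀ p ∈ Φ.source, dirDeriv ex Φ.X p = δ₁) ∧
      ∀ p ∈ Φ.source, Φ.X p = δ₁ * p.2.1 + δ₂ := by
  have hS := Φ.isOpen_source
  have hX := Φ.smooth_X
  obtain ⟨δ₁, h1⟩ := eq_const_of_dirDeriv_eq_zero hS hc (smooth_dirDeriv hS hX ex) (by
    intro p hp
    refine ⟨?_, h.dirDeriv_ex_ex_X hp, ?_⟩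
    · rw [dirDeriv_comm hS hX hp]
      exact dirDeriv_eq_zero hS (fun q hq => h.dirDeriv_et_X hq) hp
    · rw [dirDeriv_comm hS hX hp]
      exact dirDeriv_eq_zero hS (fun q hq => h.dirDeriv_eu_X hq) hp)
  have hlin : ∀ p : Base, HasFDerivAt (fun q : Base => δ₁ * q.2.1)
      (δ₁ • (ContinuousLinearMap.fst ℝ ℝ ℝ ∘L ContinuousLinearMap.snd ℝ ℝ (ℝ × ℝ))) p := fun p =>
    (ContinuousLinearMap.fst ℝ ℝ ℝ ∘L ContinuousLinearMap.snd ℝ ℝ (ℝ × ℝ)).hasFDerivAt.const_mul δ₁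
  have hd : ∀ p ∈ Φ.source, ∀ v : Base,
      dirDeriv v (fun q => Φ.X q - δ₁ * q.2.1) p = dirDeriv v Φ.X p - δ₁ * v.2.1 := by
    intro p hp v
    have := ((differentiableAt_of_smooth hS hX hp).hasFDerivAt.fun_sub (hlin p)).fderiv
    rw [dirDeriv, this]
    simp [dirDeriv]
  obtain ⟨δ₂, h2⟩ := eq_const_of_dirDeriv_eq_zero (F := fun q => Φ.X q - δ₁ * q.2.1) hS hc
    (hX.sub (by fun_prop)) (by
      intro p hp
      rw [hd p hp, hd p hp, hd p hp, h.dirDeriv_et_X hp, h.dirDeriv_eu_X hp, h1 p hp]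
      simp [et, ex, eu])
  exact ⟨δ₁, δ₂, h1, fun p hp => by linarith [h2 p hp]⟩

end Maps

/-! ### From local to global -/

theorem exists_antiderivative {D : Set ℝ} (hD : IsOpen D) (hc : IsConnected D) {f : ℝ → ℝ}
    (hf : ContinuousOn f D) : ∃ F : ℝ → ℝ, ∀ t ∈ D, HasDerivAt F (f t) t := by
  obtain ⟨t₀, ht₀⟩ := hc.nonempty
  refine ⟨fun t => ∫ s in t₀..t, f s, fun t ht => ?_⟩
  have hsub : uIcc t₀ t ⊆ D := hc.isPreconnected.ordConnected.uIcc_subset ht₀ ht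
  exact intervalIntegral.integral_hasDerivAt_right (hf.mono hsub).intervalIntegrable
    (hf.stronglyMeasurableAtFilter hD t ht) (hf.continuousAt (hD.mem_nhds ht))

theorem exists_factor_fst {S : Set Base} {F : Base → ℝ} (hS : IsOpen S) (hF : ContDiffOn ℝ ∞ F S)
    (h : ∀ p ∈ S, ∀ q ∈ S, p.1 = q.1 → F p = F q) :
    ∃ θ : ℝ → ℝ, ContDiffOn ℝ ∞ θ (Prod.fst '' S) ∧ ∀ p ∈ S, F p = θ p.1 := by
  -- The chosen points `g t` need not vary continuously; smoothness is checked on the slice through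
  -- any given point, where θ agrees with F.
  choose! g hg using fun (t : ℝ) (ht : t ∈ Prod.fst '' S) => ht
  have hθ : ∀ p ∈ S, F p = F (g p.1) := fun p hp =>
    h p hp _ (hg p.1 (mem_image_of_mem _ hp)).1 (hg p.1 (mem_image_of_mem _ hp)).2.symm
  refine ⟨fun t => F (g t), ?_, hθ⟩
  rintro _ ⟨p, hp, rfl⟩
  have hp' : (p.1, p.2) ∈ S := hp
  have hcd : ContDiff ℝ ∞ fun s : ℝ => (s, p.2) := by fun_prop
  have hmem : ∀ᶠ s in 𝓝 p.1, (s, p.2) ∈ S :=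
    (hcd.continuous.continuousAt).eventually_mem (hS.mem_nhds hp')
  have h1 : ContDiffAt ℝ ∞ (fun s : ℝ => F (s, p.2)) p.1 :=
    (hF.contDiffAt (hS.mem_nhds hp')).comp p.1 hcd.contDiffAt
  refine (h1.congr_of_eventuallyEq ?_).contDiffWithinAt
  filter_upwards [hmem] with s hs
  exact (hθ _ hs).symm

theorem isOpen_image_fst {S : Set Base} (hS : IsOpen S) : IsOpen (Prod.fst '' S) :=
  isOpenMap_fst S hS

theorem dirDeriv_comp_fst {θ : ℝ → ℝ} {p : Base} (h : DifferentiableAt ℝ θ p.1) (v : Base) :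
    dirDeriv v (fun q : Base => θ q.1) p = v.1 * deriv θ p.1 := by
  have h1 : HasFDerivAt (fun q : Base => θ q.1) (deriv θ p.1 • ContinuousLinearMap.fst ℝ ℝ _) p :=
    h.hasDerivAt.comp_hasFDerivAt p hasFDerivAt_fst
  rw [dirDeriv, h1.fderiv]
  simp [mul_comm]

section Maps

variable {E E' : Equation} {Φ : PointTransformation Base}

/-- T_x = T_u = 0 settles this only within a component of a fibre over t. Integrating δ₁² a² =
a'(T)² T_t over the whole connected domain links the components. -/
theorem MapsEquation.T_eq_of_fst_eq (h : MapsEquation Φ E E') (hc : IsPreconnected Φ.source)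
    {p q : Base} (hp : p ∈ Φ.source) (hq : q ∈ Φ.source) (hpq : p.1 = q.1) : Φ.T p = Φ.T q := by
  obtain ⟨δ₁, -, hδ, -⟩ := h.exists_X_eq hc
  obtain ⟨F, hF⟩ := exists_antiderivative E.isOpen_timeDomain E.isConnected_timeDomain
    (E.smooth_a.continuousOn.pow 2)
  obtain ⟨G, hG⟩ := exists_antiderivative E'.isOpen_timeDomain E'.isConnected_timeDomain
    (E'.smooth_a.continuousOn.pow 2)
  have hd : ∀ r ∈ Φ.source, HasFDerivAt (fun r => G (Φ.T r) - δ₁ ^ 2 * F r.1)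
      (0 : Base →L[ℝ] ℝ) r := by
    intro r hr
    have h1 : HasFDerivAt (fun r => G (Φ.T r)) (E'.a (Φ.T r) ^ 2 • fderiv ℝ Φ.T r) r :=
      (hG _ (h.1 _ hr).2).comp_hasFDerivAt r
        (differentiableAt_of_smooth Φ.isOpen_source Φ.smooth_T hr).hasFDerivAt
    have h2 : HasFDerivAt (fun r : Base => F r.1)
        (E.a r.1 ^ 2 • ContinuousLinearMap.fst ℝ ℝ (ℝ × ℝ)) r :=
      (hF _ (h.1 _ hr).1).comp_hasFDerivAt r hasFDerivAt_fst
    refine (h1.fun_sub (h2.const_mul (δ₁ ^ 2))).congr_fderiv ?_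
    refine ContinuousLinearMap.ext fun ⟨a, b, c⟩ => ?_
    have h3 := h.sq_dirDeriv_ex_X hr
    rw [hδ r hr] at h3
    have h4 := fderiv_base_apply Φ.T r a b c
    rw [(h.dirDeriv_T hr).1, (h.dirDeriv_T hr).2] at h4
    simp [h4]
    linear_combination -a * h3
  have hconst := Φ.isOpen_source.is_const_of_fderiv_eq_zero hc
    (fun r hr => (hd r hr).differentiableAt.differentiableWithinAt)
    (fun r hr => (hd r hr).fderiv) hp hq
  have hGT : G (Φ.T p) = G (Φ.T q) := by
    simp only [hpq] at hconst
    linarith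
  have hmono : StrictMonoOn G E'.timeDomain := by
    refine strictMonoOn_of_deriv_pos
      E'.isConnected_timeDomain.isPreconnected.ordConnected.convex
      (fun t ht => (hG t ht).continuousAt.continuousWithinAt) fun t ht => ?_
    have ht' := interior_subset ht
    rw [(hG t ht').deriv]
    exact sq_pos_of_ne_zero (E'.a_ne_zero t ht')
  exact hmono.injOn (h.1 _ hp).2 (h.1 _ hq).2 hGT

/-- A continuous function without zeros on a preconnected set has equal values wherever its square
has. -/
theorem eq_of_sq_eq_of_preconnected {X : Type*} [TopologicalSpace X] {S : Set X} {f : X → ℝ}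
    (hS : IsPreconnected S) (hf : ContinuousOn f S) (h0 : ∀ p ∈ S, f p ≠ 0) {p q : X} (hp : p ∈ S)
    (hq : q ∈ S) (h : f p ^ 2 = f q ^ 2) : f p = f q := by
  rcases sq_eq_sq_iff_eq_or_eq_neg.1 h with h1 | h1
  · exact h1
  · exfalso
    -- Opposite values would force a zero in between.
    have hi := (hS.image f hf).ordConnected.uIcc_subset (mem_image_of_mem f hp)
      (mem_image_of_mem f hq)
    have hz : (0 : ℝ) ∈ uIcc (f p) (f q) := by
      rw [h1, mem_uIcc]
      rcases le_total 0 (f q) with h2 | h2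
      · exact Or.inl ⟨by linarith, h2⟩
      · exact Or.inr ⟨h2, by linarith⟩
    obtain ⟨r, hr, hr0⟩ := hi hz
    exact h0 r hr hr0

theorem MapsEquation.exists_form (h : MapsEquation Φ E E') (hc : IsConnected Φ.source) :
    ∃ (θ φ : ℝ → ℝ) (δ₁ δ₂ : ℝ), IsParameters (Prod.fst '' Φ.source) θ φ δ₁ ∧
      HasForm Φ θ φ δ₁ δ₂ := by
  have hS := Φ.isOpen_source
  obtain ⟨δ₁, δ₂, hδ, hX⟩ := h.exists_X_eq hc.isPreconnected
  have hTeq : ∀ p ∈ Φ.source, ∀ q ∈ Φ.source, p.1 = q.1 → Φ.T p = Φ.T q :=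
    fun p hp q hq => h.T_eq_of_fst_eq hc.isPreconnected hp hq
  obtain ⟨θ, hθ, hT⟩ := exists_factor_fst hS Φ.smooth_T hTeq
  have hJ := isOpen_image_fst hS
  have hderiv : ∀ p ∈ Φ.source, dirDeriv et Φ.T p = deriv θ p.1 := by
    intro p hp
    rw [dirDeriv_congr (G := fun q => θ q.1) hS (fun q hq => hT q hq) hp, dirDeriv_comp_fst
      ((hθ.contDiffAt (hJ.mem_nhds (mem_image_of_mem _ hp))).differentiableAt (by simp))]
    simp [et]
  have hUeq : ∀ p ∈ Φ.source, ∀ q ∈ Φ.source, p.1 = q.1 →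
      dirDeriv eu Φ.U p = dirDeriv eu Φ.U q := by
    intro p hp q hq hpq
    -- The relation for c yields only U_u²; connectedness fixes the sign.
    refine eq_of_sq_eq_of_preconnected hc.isPreconnected
      (smooth_dirDeriv hS Φ.smooth_U eu).continuousOn
      (fun r hr => right_ne_zero_of_mul (h.jacobian_eq hr)) hp hq ?_
    have h1 := (h.U_eq hp).2
    rw [hderiv p hp, hpq, hTeq p hp q hq hpq, ← hderiv q hq, (h.U_eq hq).2] at h1
    exact (mul_left_cancel₀ (mul_ne_zero (h.dirDeriv_et_T_ne_zero hq)
      (E'.c_ne_zero _ (h.1 _ hq).2)) h1).symm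
  obtain ⟨φ, hφ, hU⟩ := exists_factor_fst hS (smooth_dirDeriv hS Φ.smooth_U eu) hUeq
  refine ⟨θ, φ, δ₁, δ₂, ⟨?_, hθ, hφ, ?_⟩, ?_⟩
  · obtain ⟨p, hp⟩ := hc.nonempty
    rw [← hδ p hp]
    exact right_ne_zero_of_mul (left_ne_zero_of_mul (h.jacobian_eq hp))
  · rintro _ ⟨p, hp, rfl⟩
    rw [← hderiv p hp, ← hU p hp]
    exact mul_ne_zero (h.dirDeriv_et_T_ne_zero hp) (right_ne_zero_of_mul (h.jacobian_eq hp))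
  · intro t x u hp
    have h1 := hT _ hp
    have h2 := hX _ hp
    have h3 := (h.U_eq hp).1
    rw [hU _ hp] at h3
    refine Prod.ext h1 (Prod.ext h2 ?_)
    exact h3.trans (mul_comm _ _)

end Maps

/-! ### Transformations of the given form -/

section Form

variable {E E' : Equation} {Φ : PointTransformation Base} {θ φ : ℝ → ℝ} {δ₁ δ₂ : ℝ}

theorem differentiableAt_of_smooth_image {S : Set Base} (hS : IsOpen S) {f : ℝ → ℝ}
    (hf : ContDiffOn ℝ ∞ f (Prod.fst '' S)) {p : Base} (hp : p ∈ S) :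
    DifferentiableAt ℝ f p.1 :=
  (hf.contDiffAt ((isOpen_image_fst hS).mem_nhds (mem_image_of_mem _ hp))).differentiableAt
    (by simp)

theorem HasForm.T_eq (h : HasForm Φ θ φ δ₁ δ₂) {p : Base} (hp : p ∈ Φ.source) :
    Φ.T p = θ p.1 :=
  congrArg Prod.fst (h p.1 p.2.1 p.2.2 hp)

theorem HasForm.X_eq (h : HasForm Φ θ φ δ₁ δ₂) {p : Base} (hp : p ∈ Φ.source) :
    Φ.X p = δ₁ * p.2.1 + δ₂ :=
  congrArg (fun q : Base => q.2.1) (h p.1 p.2.1 p.2.2 hp)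

theorem HasForm.U_eq (h : HasForm Φ θ φ δ₁ δ₂) {p : Base} (hp : p ∈ Φ.source) :
    Φ.U p = φ p.1 * p.2.2 :=
  congrArg (fun q : Base => q.2.2) (h p.1 p.2.1 p.2.2 hp)

theorem HasForm.dirDeriv_T (h : HasForm Φ θ φ δ₁ δ₂)
    (hpar : IsParameters (Prod.fst '' Φ.source) θ φ δ₁) {p : Base} (hp : p ∈ Φ.source) (v : Base) :
    dirDeriv v Φ.T p = v.1 * deriv θ p.1 := by
  rw [dirDeriv_congr (G := fun q => θ q.1) Φ.isOpen_source (fun q hq => h.T_eq hq) hp]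
  exact dirDeriv_comp_fst
    (differentiableAt_of_smooth_image Φ.isOpen_source hpar.smooth_theta hp) v

theorem HasForm.dirDeriv_X (h : HasForm Φ θ φ δ₁ δ₂) {p : Base} (hp : p ∈ Φ.source) (v : Base) :
    dirDeriv v Φ.X p = δ₁ * v.2.1 := by
  rw [dirDeriv_congr (G := fun q => δ₁ * q.2.1 + δ₂) Φ.isOpen_source (fun q hq => h.X_eq hq) hp]
  have h1 : HasFDerivAt (fun q : Base => δ₁ * q.2.1 + δ₂)
      (δ₁ • (ContinuousLinearMap.fst ℝ ℝ ℝ ∘L ContinuousLinearMap.snd ℝ ℝ (ℝ × ℝ))) p :=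
    ((ContinuousLinearMap.fst ℝ ℝ ℝ ∘L
      ContinuousLinearMap.snd ℝ ℝ (ℝ × ℝ)).hasFDerivAt.const_mul δ₁).add_const δ₂
  rw [dirDeriv, h1.fderiv]
  simp

theorem HasForm.dirDeriv_U (h : HasForm Φ θ φ δ₁ δ₂)
    (hpar : IsParameters (Prod.fst '' Φ.source) θ φ δ₁) {p : Base} (hp : p ∈ Φ.source) (v : Base) :
    dirDeriv v Φ.U p = v.1 * deriv φ p.1 * p.2.2 + φ p.1 * v.2.2 := by
  rw [dirDeriv_congr (G := fun q => φ q.1 * q.2.2) Φ.isOpen_source (fun q hq => h.U_eq hq) hp]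
  have h1 : HasFDerivAt (fun q : Base => φ q.1) (deriv φ p.1 • ContinuousLinearMap.fst ℝ ℝ _) p :=
    (differentiableAt_of_smooth_image Φ.isOpen_source
      hpar.smooth_phi hp).hasDerivAt.comp_hasFDerivAt p hasFDerivAt_fst
  have h2 : HasFDerivAt (fun q : Base => q.2.2)
      (ContinuousLinearMap.snd ℝ ℝ ℝ ∘L ContinuousLinearMap.snd ℝ ℝ (ℝ × ℝ)) p :=
    (ContinuousLinearMap.snd ℝ ℝ ℝ ∘L ContinuousLinearMap.snd ℝ ℝ (ℝ × ℝ)).hasFDerivAt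
  rw [dirDeriv, (h1.fun_mul h2).fderiv]
  simp
  ring

theorem IsParameters.deriv_ne_zero {J : Set ℝ} (h : IsParameters J θ φ δ₁) {t : ℝ} (ht : t ∈ J) :
    deriv θ t ≠ 0 :=
  left_ne_zero_of_mul (h.ne_zero t ht)

theorem IsParameters.phi_ne_zero {J : Set ℝ} (h : IsParameters J θ φ δ₁) {t : ℝ} (ht : t ∈ J) :
    φ t ≠ 0 :=
  right_ne_zero_of_mul (h.ne_zero t ht)

theorem HasForm.totalDx0_X (h : HasForm Φ θ φ δ₁ δ₂) {j : Jet1} (hj : j.base ∈ Φ.source) :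
    totalDx0 Φ.X j = δ₁ := by
  rw [totalDx0_eq, h.dirDeriv_X hj, h.dirDeriv_X hj]
  simp [ex, eu]

theorem HasForm.newUt_eq (h : HasForm Φ θ φ δ₁ δ₂)
    (hpar : IsParameters (Prod.fst '' Φ.source) θ φ δ₁) {j : Jet1} (hj : j.base ∈ Φ.source) :
    Φ.newUt j = (deriv φ j.1 * j.2.2.1 + φ j.1 * j.2.2.2.1) / deriv θ j.1 := by
  have hδ := hpar.delta_ne_zero
  rw [PointTransformation.newUt_of_T (by
    rw [h.dirDeriv_T hpar hj, h.dirDeriv_T hpar hj]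
    simp [ex, eu]), h.totalDx0_X hj, totalDt0_eq Φ.X, h.dirDeriv_X hj, h.dirDeriv_X hj,
    totalDt0_eq Φ.U, h.dirDeriv_U hpar hj, h.dirDeriv_U hpar hj, h.dirDeriv_T hpar hj]
  simp [et, eu, Jet1.base]
  field_simp

theorem HasForm.newUxx_eq (h : HasForm Φ θ φ δ₁ δ₂)
    (hpar : IsParameters (Prod.fst '' Φ.source) θ φ δ₁) {j : Jet2}
    (hj : j.toJet1.base ∈ Φ.source) :
    Φ.newDx Φ.newUx j = φ j.t / δ₁ ^ 2 * j.uxx := by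
  have hS := Φ.isOpen_source
  have hδ := hpar.delta_ne_zero
  have hX := h.totalDx0_X hj
  have e1 : dirDeriv ex (dirDeriv ex Φ.U) j.toJet1.base = 0 :=
    dirDeriv_eq_zero (k := 0) hS (fun q hq => by rw [h.dirDeriv_U hpar hq]; simp [ex]) hj
  have e2 : dirDeriv ex (dirDeriv eu Φ.U) j.toJet1.base = 0 := by
    rw [dirDeriv_comm hS Φ.smooth_U hj]
    exact dirDeriv_eq_zero (k := 0) hS (fun q hq => by rw [h.dirDeriv_U hpar hq]; simp [ex]) hj
  have e3 : dirDeriv eu (dirDeriv eu Φ.U) j.toJet1.base = 0 := by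
    rw [dirDeriv_congr (G := fun q => φ q.1) hS
      (fun q hq => by simp only [h.dirDeriv_U hpar hq]; simp [eu]) hj,
      dirDeriv_comp_fst (differentiableAt_of_smooth_image hS hpar.smooth_phi hj)]
    simp [eu]
  have e4 : ∀ v w : Base, dirDeriv v (dirDeriv w Φ.X) j.toJet1.base = 0 := fun v w =>
    dirDeriv_eq_zero hS (fun q hq => h.dirDeriv_X hq w) hj
  rw [PointTransformation.newDx_newUx_of_T (fun p hp => by
      rw [h.dirDeriv_T hpar hp, h.dirDeriv_T hpar hp]
      simp [ex, eu]) hj (by rwa [hX]), totalDx1_totalDx0 hS Φ.smooth_U hj,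
    totalDx1_totalDx0 hS Φ.smooth_X hj, hX, e1, e2, e3, e4, e4, e4, h.dirDeriv_X hj,
    h.dirDeriv_U hpar hj]
  simp [eu, Jet1.base, Jet2.toJet1]
  field_simp

theorem HasForm.elementFormulas (h : HasForm Φ θ φ δ₁ δ₂)
    (hpar : IsParameters (Prod.fst '' Φ.source) θ φ δ₁) (hm : MapsEquation Φ E E') {p : Base}
    (hp : p ∈ Φ.source) :
    ElementFormulas θ φ δ₁ p.1 (E.a p.1, E.b p.1, E.c p.1)
      (E'.a (θ p.1), E'.b (θ p.1), E'.c (θ p.1)) := by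
  have hθ := hpar.deriv_ne_zero (mem_image_of_mem _ hp)
  have hφ := hpar.phi_ne_zero (mem_image_of_mem _ hp)
  have h1 := hm.sq_dirDeriv_ex_X hp
  have h2 := (hm.U_eq hp).2
  rw [h.dirDeriv_X hp, h.dirDeriv_T hpar hp, h.T_eq hp] at h1
  rw [h.dirDeriv_U hpar hp, h.dirDeriv_T hpar hp, h.T_eq hp] at h2
  simp only [ex, et, eu, mul_one, one_mul, zero_mul, zero_add] at h1 h2
  refine ⟨?_, ?_, ?_⟩
  · simp only
    field_simp
    linear_combination -h1
  · simp only
    -- The relation for b appears multiplied by u, so it is read off at a point over the same time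
    -- with u ≠ 0.
    obtain ⟨s, hs, hs0⟩ : ∃ s : ℝ, p + s • eu ∈ Φ.source ∧ p.2.2 + s ≠ 0 := by
      have e1 := (eventually_line_mem Φ.isOpen_source hp eu).filter_mono
        (nhdsWithin_le_nhds (s := {0}ᶜ))
      have e2 : ∀ᶠ s : ℝ in 𝓝[≠] 0, p.2.2 + s ≠ 0 := by
        by_cases hu : p.2.2 = 0
        · filter_upwards [self_mem_nhdsWithin] with s hs
          rw [hu, zero_add]
          exact hs
        · have hc : ContinuousAt (fun s : ℝ => p.2.2 + s) 0 := by fun_prop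
          exact (hc.eventually_ne (by simpa using hu)).filter_mono nhdsWithin_le_nhds
      exact (e1.and e2).exists
    have hd := (hm.determining hs).2.2
    have hUxx : dirDeriv ex (dirDeriv ex Φ.U) (p + s • eu) = 0 :=
      dirDeriv_eq_zero (k := 0) Φ.isOpen_source
        (fun q hq => by rw [h.dirDeriv_U hpar hq]; simp [ex]) hs
    rw [hm.dirDeriv_et_X hs, h.dirDeriv_U hpar hs, h.dirDeriv_U hpar hs, h.dirDeriv_T hpar hs,
      h.U_eq hs, h.T_eq hs, hUxx] at hd
    simp only [et, eu, Prod.fst_add, Prod.snd_add, Prod.smul_fst, Prod.smul_snd, smul_eq_mul,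
      mul_one, mul_zero, add_zero, one_mul, zero_mul, zero_add, zero_div, sub_zero] at hd
    have h3 : (p.2.2 + s) * (deriv φ p.1 + E.b p.1 * φ p.1) =
        (p.2.2 + s) * (deriv θ p.1 * E'.b (θ p.1) * φ p.1) := by
      linear_combination hd + (p.2.2 + s) ^ 3 * φ p.1 * h2
    have h4 := mul_left_cancel₀ hs0 h3
    field_simp
    linear_combination -h4
  · simp only
    field_simp
    linear_combination -h2

/-- The pulled-back equation is φ/θ_t times the initial one, which gives both implications. -/
theorem HasForm.mapsEquation (h : HasForm Φ θ φ δ₁ δ₂)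
    (hpar : IsParameters (Prod.fst '' Φ.source) θ φ δ₁) (hfit : Fits Φ E E')
    (hel : ∀ p ∈ Φ.source, ElementFormulas θ φ δ₁ p.1 (E.a p.1, E.b p.1, E.c p.1)
      (E'.a (θ p.1), E'.b (θ p.1), E'.c (θ p.1))) : MapsEquation Φ E E' := by
  refine ⟨hfit, fun j hj _ => ?_⟩
  have hθ := hpar.deriv_ne_zero (mem_image_of_mem _ hj)
  have hφ := hpar.phi_ne_zero (mem_image_of_mem _ hj)
  have hδ := hpar.delta_ne_zero
  obtain ⟨h1, h2, h3⟩ := hel _ hj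
  have hf := hfit _ hj
  have h4 := h.newUt_eq hpar hj
  have h5 := h.newUxx_eq hpar hj
  have hT := h.T_eq hj
  have hU := h.U_eq hj
  obtain ⟨t, x, u, ut, ux, utt, utx, uxx⟩ := j
  simp only [Jet2.toJet1, Jet1.base] at *
  simp only [Equation.manifold, mem_ofPred_eq, PointTransformation.prolong, Jet2.toJet1, Jet1.base]
  simp only [hf.1, hf.2, true_and, h4, h5, hU]
  rw [hT, h1, h2, h3]
  constructor
  · intro he
    rw [he]
    field_simp
    ring
  · intro he
    field_simp at he
    have : φ t * ut = φ t * (E.a t ^ 2 * uxx + E.b t * u - E.c t * u ^ 3) := by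
      linear_combination he
    exact mul_left_cancel₀ hφ this

end Form

/-! ### Transformations of the extended space -/

theorem exists_smooth_inverse {J : Set ℝ} {θ : ℝ → ℝ} (hJ : IsOpen J) (hθ : ContDiffOn ℝ ∞ θ J)
    (h0 : ∀ t ∈ J, deriv θ t ≠ 0) (hinj : InjOn θ J) :
    IsOpen (θ '' J) ∧ ∃ η : ℝ → ℝ, ContDiffOn ℝ ∞ η (θ '' J) ∧ ∀ t ∈ J, η (θ t) = t := by
  have hcd : ∀ t ∈ J, ContDiffAt ℝ ∞ θ t := fun t ht => hθ.contDiffAt (hJ.mem_nhds ht)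
  have hsd : ∀ t ∈ J, HasStrictDerivAt θ (deriv θ t) t := fun t ht =>
    (hcd t ht).hasStrictDerivAt (by simp)
  refine ⟨isOpen_iff_mem_nhds.2 ?_, ?_⟩
  · rintro _ ⟨t, ht, rfl⟩
    rw [← (hsd t ht).map_nhds_eq (h0 t ht)]
    exact image_mem_map (hJ.mem_nhds ht)
  · refine ⟨Function.invFunOn θ J, ?_, fun t ht => hinj.leftInvOn_invFunOn ht⟩
    rintro _ ⟨t, ht, rfl⟩
    set f' : ℝ ≃L[ℝ] ℝ := ContinuousLinearEquiv.unitsEquivAut ℝ (Units.mk0 _ (h0 t ht)) with hf'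
    have hfd : HasFDerivAt θ (f' : ℝ →L[ℝ] ℝ) t := by
      refine (hsd t ht).hasDerivAt.hasFDerivAt.congr_fderiv ?_
      ext
      simp [hf']
    have hn : (∞ : ℕ∞ω) ≠ 0 := by simp
    have hsm := (hcd t ht).to_localInverse hfd hn
    have hst := (hcd t ht).hasStrictFDerivAt' hfd hn
    have hcont : ContinuousAt (hst.localInverse θ f' t) (θ t) := hst.localInverse_continuousAt
    have hmem : ∀ᶠ y in 𝓝 (θ t), hst.localInverse θ f' t y ∈ J :=
      hcont.eventually_mem (by
        rw [hst.localInverse_apply_image]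
        exact hJ.mem_nhds ht)
    -- Injectivity on J makes the global inverse agree near θ(t) with the smooth local one.
    refine (hsm.congr_of_eventuallyEq ?_).contDiffWithinAt
    filter_upwards [hmem, hst.eventually_right_inverse] with y hy1 hy2
    refine (congrArg (Function.invFunOn θ J) hy2).symm.trans (hinj.leftInvOn_invFunOn hy1)

theorem injOn_of_deriv_pos {J : Set ℝ} {θ : ℝ → ℝ} (hJ : IsOpen J) (hc : IsPreconnected J)
    (hθ : ContDiffOn ℝ ∞ θ J) (h0 : ∀ t ∈ J, 0 < deriv θ t) : InjOn θ J :=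
  (strictMonoOn_of_deriv_pos hc.ordConnected.convex hθ.continuousOn
    (by rwa [hJ.interior_eq])).injOn

section Construction

variable (Φ : PointTransformation Base) {k₁ k₂ k₃ l : ℝ → ℝ}

theorem bijective_of_injective_clm {V : Type*} [NormedAddCommGroup V] [NormedSpace ℝ V]
    [FiniteDimensional ℝ V] (L : V →L[ℝ] V) (h : ∀ v, L v = 0 → v = 0) : Function.Bijective L := by
  have hi : Function.Injective (L : V →ₗ[ℝ] V) := (injective_iff_map_eq_zero _).2 h
  exact ⟨hi, LinearMap.injective_iff_surjective.1 hi⟩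

/-- The extension of a point transformation by maps of the arbitrary elements that are affine with
coefficients depending on time. -/
noncomputable def extendMap (k₁ k₂ k₃ l : ℝ → ℝ) (z : Base × (ℝ × ℝ × ℝ)) : Base × (ℝ × ℝ × ℝ) :=
  (Φ.toFun z.1, (k₁ z.1.1 * z.2.1, k₂ z.1.1 * z.2.2.1 + l z.1.1, k₃ z.1.1 * z.2.2.2))

theorem isOpen_elementValues : IsOpen elementValues :=
  (isOpen_ne_fun continuous_fst continuous_const).inter
    (isOpen_ne_fun (continuous_snd.comp continuous_snd) continuous_const)

variable {Φ}

theorem smooth_comp_time {J : Set ℝ} {f : ℝ → ℝ} (hf : ContDiffOn ℝ ∞ f J)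
    {S : Set (Base × (ℝ × ℝ × ℝ))} (hS : ∀ z ∈ S, z.1.1 ∈ J) :
    ContDiffOn ℝ ∞ (fun z : Base × (ℝ × ℝ × ℝ) => f z.1.1) S :=
  hf.comp (t := J) (by fun_prop) hS

theorem smooth_extendMap (h₁ : ContDiffOn ℝ ∞ k₁ (Prod.fst '' Φ.source))
    (h₂ : ContDiffOn ℝ ∞ k₂ (Prod.fst '' Φ.source))
    (h₃ : ContDiffOn ℝ ∞ k₃ (Prod.fst '' Φ.source)) (hl : ContDiffOn ℝ ∞ l (Prod.fst '' Φ.source)) :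
    ContDiffOn ℝ ∞ (extendMap Φ k₁ k₂ k₃ l) (Φ.source ×ˢ elementValues) := by
  have hS : ∀ z ∈ Φ.source ×ˢ elementValues, z.1.1 ∈ Prod.fst '' Φ.source :=
    fun z hz => mem_image_of_mem _ hz.1
  have a₁ := smooth_comp_time h₁ hS
  have a₂ := smooth_comp_time h₂ hS
  have a₃ := smooth_comp_time h₃ hS
  have al := smooth_comp_time hl hS
  refine (Φ.smooth.comp contDiffOn_fst fun z hz => hz.1).prodMk
    ((a₁.mul (by fun_prop)).prodMk (((a₂.mul (by fun_prop)).add al).prodMk (a₃.mul (by fun_prop))))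

theorem bijective_fderiv_extendMap (h₁ : ContDiffOn ℝ ∞ k₁ (Prod.fst '' Φ.source))
    (h₂ : ContDiffOn ℝ ∞ k₂ (Prod.fst '' Φ.source))
    (h₃ : ContDiffOn ℝ ∞ k₃ (Prod.fst '' Φ.source)) (hl : ContDiffOn ℝ ∞ l (Prod.fst '' Φ.source))
    (h0 : ∀ t ∈ Prod.fst '' Φ.source, k₁ t ≠ 0 ∧ k₂ t ≠ 0 ∧ k₃ t ≠ 0)
    {z : Base × (ℝ × ℝ × ℝ)} (hz : z ∈ Φ.source ×ˢ elementValues) :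
    Function.Bijective (fderiv ℝ (extendMap Φ k₁ k₂ k₃ l) z) := by
  have hO : IsOpen (Φ.source ×ˢ elementValues) := Φ.isOpen_source.prod isOpen_elementValues
  have hd : DifferentiableAt ℝ (extendMap Φ k₁ k₂ k₃ l) z :=
    ((smooth_extendMap h₁ h₂ h₃ hl).contDiffAt (hO.mem_nhds hz)).differentiableAt (by simp)
  obtain ⟨n₁, n₂, n₃⟩ := h0 _ (mem_image_of_mem _ hz.1)
  have hΦ : DifferentiableAt ℝ Φ.toFun z.1 :=
    (Φ.smooth.contDiffAt (Φ.isOpen_source.mem_nhds hz.1)).differentiableAt (by simp)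
  refine bijective_of_injective_clm _ fun v hv => ?_
  have e1 : fderiv ℝ Φ.toFun z.1 v.1 = 0 := by
    have f1 : HasFDerivAt (fun y => (extendMap Φ k₁ k₂ k₃ l y).1)
        ((ContinuousLinearMap.fst ℝ _ _).comp (fderiv ℝ (extendMap Φ k₁ k₂ k₃ l) z)) z :=
      hd.hasFDerivAt.fst
    have f2 : HasFDerivAt (fun y : Base × (ℝ × ℝ × ℝ) => Φ.toFun y.1)
        ((fderiv ℝ Φ.toFun z.1).comp (ContinuousLinearMap.fst ℝ _ _)) z :=
      hΦ.hasFDerivAt.comp z hasFDerivAt_fst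
    have f3 := congrArg (fun L => L v) (f1.unique f2)
    simpa [hv] using f3.symm
  have e2 : v.1 = 0 := by
    apply (Φ.nondegenerate z.1 hz.1).injective
    rw [e1, map_zero]
  obtain ⟨v₁, w₁, w₂, w₃⟩ := v
  simp only at e2
  subst e2
  -- On directions with zero base part the differential is diagonal with entries k₁, k₂, k₃.
  have g1 := hasDerivAt_line_zero hd (0, w₁, w₂, w₃)
  rw [hv] at g1
  have hlin : ∀ a k w b : ℝ, HasDerivAt (fun s : ℝ => k * (a + s * w) + b) (k * w) 0 := by
    intro a k w b
    simpa using ((((hasDerivAt_id' (0 : ℝ)).mul_const w).const_add a).const_mul k).add_const b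
  have g2 : HasDerivAt (fun s : ℝ => extendMap Φ k₁ k₂ k₃ l (z + s • (0, w₁, w₂, w₃)))
      (0, k₁ z.1.1 * w₁, k₂ z.1.1 * w₂, k₃ z.1.1 * w₃) 0 := by
    have := (hasDerivAt_const (0 : ℝ) (Φ.toFun z.1)).prodMk
      ((hlin z.2.1 (k₁ z.1.1) w₁ 0).prodMk ((hlin z.2.2.1 (k₂ z.1.1) w₂ (l z.1.1)).prodMk
        (hlin z.2.2.2 (k₃ z.1.1) w₃ 0)))
    convert this using 1
    ext s : 1
    simp [extendMap]
  have g3 := g1.unique g2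
  rw [eq_comm, Prod.ext_iff, Prod.ext_iff, Prod.ext_iff] at g3
  simp [n₁, n₂, n₃] at g3
  obtain ⟨rfl, rfl, rfl⟩ := g3
  rfl

/-- The extended transformation given by affine maps of the arbitrary elements. -/
theorem exists_extension (h₁ : ContDiffOn ℝ ∞ k₁ (Prod.fst '' Φ.source))
    (h₂ : ContDiffOn ℝ ∞ k₂ (Prod.fst '' Φ.source))
    (h₃ : ContDiffOn ℝ ∞ k₃ (Prod.fst '' Φ.source)) (hl : ContDiffOn ℝ ∞ l (Prod.fst '' Φ.source))
    (h0 : ∀ t ∈ Prod.fst '' Φ.source, k₁ t ≠ 0 ∧ k₂ t ≠ 0 ∧ k₃ t ≠ 0) :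
    ∃ Ψ : ExtendedTransformation, Ψ.base = Φ ∧ Ψ.total.toFun = extendMap Φ k₁ k₂ k₃ l := by
  refine ⟨{ base := Φ
            total :=
              { source := Φ.source ×ˢ elementValues
                toFun := extendMap Φ k₁ k₂ k₃ l
                isOpen_source := Φ.isOpen_source.prod isOpen_elementValues
                smooth := smooth_extendMap h₁ h₂ h₃ hl
                injOn := ?_
                nondegenerate := fun z hz => bijective_fderiv_extendMap h₁ h₂ h₃ hl h0 hz }
            source_total := rfl
            projectable := fun z _ => rfl }, rfl, rfl⟩
  rintro ⟨p, a, b, c⟩ hz ⟨p', a', b', c'⟩ hz' heq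
  simp only [extendMap, Prod.mk.injEq] at heq
  obtain ⟨e0, e1, e2, e3⟩ := heq
  have hp := Φ.injOn hz.1 hz'.1 e0
  simp only at hp
  subst hp
  obtain ⟨n₁, n₂, n₃⟩ := h0 _ (mem_image_of_mem _ hz.1)
  simp only at n₁ n₂ n₃
  rw [mul_left_cancel₀ n₁ e1, mul_left_cancel₀ n₂ (add_right_cancel e2), mul_left_cancel₀ n₃ e3]

variable {θ φ : ℝ → ℝ} {δ₁ δ₂ : ℝ}

/-- Every transformation of the given form extends, with a prescribed smooth square root of
`δ₁² / θ_t` as the factor of `a`. -/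
theorem HasForm.exists_extension (h : HasForm Φ θ φ δ₁ δ₂)
    (hpar : IsParameters (Prod.fst '' Φ.source) θ φ δ₁)
    (h₁ : ContDiffOn ℝ ∞ k₁ (Prod.fst '' Φ.source))
    (hsq : ∀ t ∈ Prod.fst '' Φ.source, k₁ t ^ 2 = δ₁ ^ 2 / deriv θ t) :
    ∃ Ψ : ExtendedTransformation, Ψ.base = Φ ∧ Ψ.IsGivenBy θ φ δ₁ δ₂ ∧
      ∀ p q, (Ψ.total.toFun (p, q)).2.1 = k₁ p.1 * q.1 := by
  have hJ := isOpen_image_fst Φ.isOpen_source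
  have dθ : ContDiffOn ℝ ∞ (deriv θ) (Prod.fst '' Φ.source) :=
    hpar.smooth_theta.deriv_of_isOpen hJ le_rfl
  have dφ : ContDiffOn ℝ ∞ (deriv φ) (Prod.fst '' Φ.source) :=
    hpar.smooth_phi.deriv_of_isOpen hJ le_rfl
  have hθ := fun t ht => hpar.deriv_ne_zero (t := t) ht
  have hφ := fun t ht => hpar.phi_ne_zero (t := t) ht
  obtain ⟨Ψ, hb, hΨ⟩ := NWS.exists_extension (Φ := Φ) (k₁ := k₁) (k₂ := fun t => 1 / deriv θ t)
    (k₃ := fun t => 1 / (φ t ^ 2 * deriv θ t)) (l := fun t => deriv φ t / (φ t * deriv θ t)) h₁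
    (contDiffOn_const.div dθ hθ)
    (contDiffOn_const.div ((hpar.smooth_phi.pow 2).mul dθ)
      fun t ht => mul_ne_zero (pow_ne_zero 2 (hφ t ht)) (hθ t ht))
    (dφ.div (hpar.smooth_phi.mul dθ) fun t ht => mul_ne_zero (hφ t ht) (hθ t ht)) (by
      intro t ht
      have n1 := hθ t ht
      have n2 := hφ t ht
      refine ⟨?_, by positivity, by positivity⟩
      intro h0
      have h3 := hsq t ht
      rw [h0, zero_pow two_ne_zero] at h3
      exact div_ne_zero (pow_ne_zero 2 hpar.delta_ne_zero) n1 h3.symm)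
  refine ⟨Ψ, hb, ⟨by rwa [hb], ?_⟩, fun p q => by rw [hΨ, extendMap]⟩
  intro p hp q _
  rw [hb] at hp
  have hm : p.1 ∈ Prod.fst '' Φ.source := mem_image_of_mem _ hp
  have n1 := hθ _ hm
  have n2 := hφ _ hm
  rw [hΨ]
  refine ⟨?_, ?_, rfl⟩
  · simp only [extendMap]
    rw [mul_pow, hsq _ hm]
  · simp only [extendMap]
    field_simp

/-- The point transformation with given parameters. -/
theorem exists_pointTransformation {Ω : Set Base} (hΩ : IsOpen Ω) (hc : IsConnected Ω)
    (hpar : IsParameters (Prod.fst '' Ω) θ φ δ₁) (hpos : ∀ t ∈ Prod.fst '' Ω, 0 < deriv θ t)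
    (δ₂ : ℝ) : ∃ Φ : PointTransformation Base, Φ.source = Ω ∧ HasForm Φ θ φ δ₁ δ₂ := by
  have hmem : ∀ p ∈ Ω, p.1 ∈ Prod.fst '' Ω := fun p hp => mem_image_of_mem _ hp
  have sθ : ContDiffOn ℝ ∞ (fun p : Base => θ p.1) Ω :=
    hpar.smooth_theta.comp contDiffOn_fst hmem
  have sφ : ContDiffOn ℝ ∞ (fun p : Base => φ p.1) Ω :=
    hpar.smooth_phi.comp contDiffOn_fst hmem
  have hinj := injOn_of_deriv_pos (isOpen_image_fst hΩ)
    (hc.isPreconnected.image _ continuous_fst.continuousOn) hpar.smooth_theta hpos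
  refine ⟨{ source := Ω
            toFun := fun p => (θ p.1, δ₁ * p.2.1 + δ₂, φ p.1 * p.2.2)
            isOpen_source := hΩ
            smooth := sθ.prodMk (ContDiffOn.prodMk (by fun_prop) (sφ.mul (by fun_prop)))
            injOn := ?_
            nondegenerate := ?_ }, rfl, fun t x u _ => rfl⟩
  · rintro ⟨t, x, u⟩ hp ⟨t', x', u'⟩ hp' heq
    simp only [Prod.mk.injEq] at heq
    obtain ⟨e1, e2, e3⟩ := heq
    have ht := hinj (hmem _ hp) (hmem _ hp') e1
    simp only at ht
    subst ht
    rw [mul_left_cancel₀ hpar.delta_ne_zero (add_right_cancel e2),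
      mul_left_cancel₀ (hpar.phi_ne_zero (hmem _ hp)) e3]
  · intro p hp
    have h1 : HasFDerivAt (fun q : Base => θ q.1)
        (deriv θ p.1 • ContinuousLinearMap.fst ℝ ℝ (ℝ × ℝ)) p :=
      (differentiableAt_of_smooth_image hΩ hpar.smooth_theta hp).hasDerivAt.comp_hasFDerivAt p
        hasFDerivAt_fst
    have h2 : HasFDerivAt (fun q : Base => δ₁ * q.2.1 + δ₂)
        (δ₁ • (ContinuousLinearMap.fst ℝ ℝ ℝ ∘L ContinuousLinearMap.snd ℝ ℝ (ℝ × ℝ))) p :=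
      ((ContinuousLinearMap.fst ℝ ℝ ℝ ∘L
        ContinuousLinearMap.snd ℝ ℝ (ℝ × ℝ)).hasFDerivAt.const_mul δ₁).add_const δ₂
    have h3 : HasFDerivAt (fun q : Base => φ q.1)
        (deriv φ p.1 • ContinuousLinearMap.fst ℝ ℝ (ℝ × ℝ)) p :=
      (differentiableAt_of_smooth_image hΩ hpar.smooth_phi hp).hasDerivAt.comp_hasFDerivAt p
        hasFDerivAt_fst
    have h4 : HasFDerivAt (fun q : Base => q.2.2)
        (ContinuousLinearMap.snd ℝ ℝ ℝ ∘L ContinuousLinearMap.snd ℝ ℝ (ℝ × ℝ)) p :=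
      (ContinuousLinearMap.snd ℝ ℝ ℝ ∘L ContinuousLinearMap.snd ℝ ℝ (ℝ × ℝ)).hasFDerivAt
    rw [(h1.prodMk (h2.prodMk (h3.fun_mul h4))).fderiv]
    refine bijective_of_injective_clm _ ?_
    rintro ⟨a, b, c⟩ hv
    have n1 := hpar.deriv_ne_zero (hmem _ hp)
    have n2 := hpar.phi_ne_zero (hmem _ hp)
    have n3 := hpar.delta_ne_zero
    simp [n1, n3] at hv
    obtain ⟨rfl, rfl, e3⟩ := hv
    simpa [n2] using e3

end Construction

/-! ### The equivalence group and the normalization of the class -/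

section Group

variable {Ψ : ExtendedTransformation} {E E' : Equation} {θ φ : ℝ → ℝ} {δ₁ δ₂ : ℝ}

/-- The equation with constant coefficients. -/
def Equation.const (q : ℝ × ℝ × ℝ) (hq : q ∈ elementValues) : Equation where
  timeDomain := univ
  isOpen_timeDomain := isOpen_univ
  isConnected_timeDomain := isConnected_univ
  a := fun _ => q.1
  b := fun _ => q.2.1
  c := fun _ => q.2.2
  smooth_a := contDiffOn_const
  smooth_b := contDiffOn_const
  smooth_c := contDiffOn_const
  a_ne_zero := fun _ _ => hq.1
  c_ne_zero := fun _ _ => hq.2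

/-- One equation with constant coefficients fixes the parameters, since they depend only on the base
transformation; then the constant equation with value q yields the formulas at q. -/
theorem exists_isGivenBy (h : Ψ ∈ equivalenceGroup) :
    ∃ (θ φ : ℝ → ℝ) (δ₁ δ₂ : ℝ),
      IsParameters (Prod.fst '' Ψ.base.source) θ φ δ₁ ∧ Ψ.IsGivenBy θ φ δ₁ δ₂ := by
  obtain ⟨hc, hE⟩ := h
  have h1 : ((1, 0, 1) : ℝ × ℝ × ℝ) ∈ elementValues := ⟨one_ne_zero, one_ne_zero⟩
  obtain ⟨_, -, hm⟩ := hE (Equation.const _ h1) fun _ _ => mem_univ _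
  obtain ⟨θ, φ, δ₁, δ₂, hpar, hf⟩ := hm.exists_form hc
  refine ⟨θ, φ, δ₁, δ₂, hpar, hf, fun p hp q hq => ?_⟩
  obtain ⟨E', ht, hm'⟩ := hE (Equation.const q hq) fun _ _ => mem_univ _
  have h2 := hf.elementFormulas hpar hm' hp
  have h3 := ht.2 p hp
  rw [hf.T_eq hp] at h3
  rw [← h3] at h2
  exact h2

theorem ExtendedTransformation.IsGivenBy.deriv_pos (h : Ψ.IsGivenBy θ φ δ₁ δ₂)
    (hpar : IsParameters (Prod.fst '' Ψ.base.source) θ φ δ₁) :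
    ∀ t ∈ Prod.fst '' Ψ.base.source, 0 < deriv θ t := by
  rintro _ ⟨p, hp, rfl⟩
  have h1 := (h.2 p hp (1, 0, 1) ⟨one_ne_zero, one_ne_zero⟩).1
  have h2 := hpar.deriv_ne_zero (mem_image_of_mem _ hp)
  have h3 := sq_pos_of_ne_zero hpar.delta_ne_zero
  by_contra hle
  have h4 : deriv θ p.1 < 0 := lt_of_le_of_ne (not_lt.1 hle) h2
  have h5 := div_neg_of_pos_of_neg h3 h4
  have h6 := sq_nonneg (Ψ.total.toFun (p, (1, 0, 1))).2.1
  rw [h1] at h6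
  simp only [one_pow, mul_one] at h6
  linarith

theorem ExtendedTransformation.IsGivenBy.mapsEquation (h : Ψ.IsGivenBy θ φ δ₁ δ₂)
    (hpar : IsParameters (Prod.fst '' Ψ.base.source) θ φ δ₁) (ht : Ψ.TransformsElements E E') :
    MapsEquation Ψ.base E E' := by
  refine h.1.mapsEquation hpar ht.1 fun p hp => ?_
  have hfit := (ht.1 p hp).1
  have h1 := h.2 p hp (E.a p.1, E.b p.1, E.c p.1) ⟨E.a_ne_zero _ hfit, E.c_ne_zero _ hfit⟩
  rwa [ht.2 p hp, h.1.T_eq hp] at h1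

/-- The transformed values along `E` depend on t only, and composing them with the inverse of θ
gives the coefficients of the target. -/
theorem ExtendedTransformation.IsGivenBy.exists_target (h : Ψ.IsGivenBy θ φ δ₁ δ₂)
    (hc : IsConnected Ψ.base.source)
    (hpar : IsParameters (Prod.fst '' Ψ.base.source) θ φ δ₁)
    (hE : ∀ p ∈ Ψ.base.source, p.1 ∈ E.timeDomain) : ∃ E', Ψ.TransformsElements E E' := by
  have hS := Ψ.base.isOpen_source
  have hJ := isOpen_image_fst hS
  have hJc : IsConnected (Prod.fst '' Ψ.base.source) := hc.image _ continuous_fst.continuousOn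
  have hpos := h.deriv_pos hpar
  obtain ⟨hO, η, hη, hηθ⟩ := exists_smooth_inverse hJ hpar.smooth_theta
    (fun t ht => hpar.deriv_ne_zero ht)
    (injOn_of_deriv_pos hJ hJc.isPreconnected hpar.smooth_theta hpos)
  have hval : ∀ p ∈ Ψ.base.source, (E.a p.1, E.b p.1, E.c p.1) ∈ elementValues := fun p hp =>
    ⟨E.a_ne_zero _ (hE p hp), E.c_ne_zero _ (hE p hp)⟩
  have hform := fun p hp => h.2 p hp _ (hval p hp)
  set f : Base → ℝ × ℝ × ℝ := fun p => (Ψ.total.toFun (p, (E.a p.1, E.b p.1, E.c p.1))).2 with hf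
  have hsm : ContDiffOn ℝ ∞ f Ψ.base.source := by
    have e : ∀ g : ℝ → ℝ, ContDiffOn ℝ ∞ g E.timeDomain →
        ContDiffOn ℝ ∞ (fun p : Base => g p.1) Ψ.base.source := fun g hg =>
      hg.comp contDiffOn_fst hE
    refine contDiff_snd.comp_contDiffOn (Ψ.total.smooth.comp (contDiffOn_id.prodMk
      ((e _ E.smooth_a).prodMk ((e _ E.smooth_b).prodMk (e _ E.smooth_c)))) fun p hp => ?_)
    rw [Ψ.source_total]
    exact ⟨hp, hval p hp⟩
  have hne : ∀ p ∈ Ψ.base.source, (f p).1 ≠ 0 ∧ (f p).2.2 ≠ 0 := by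
    intro p hp
    obtain ⟨f1, -, f3⟩ := hform p hp
    have hm := mem_image_of_mem Prod.fst hp
    have n1 := hpar.deriv_ne_zero hm
    have n2 := hpar.phi_ne_zero hm
    have n3 := hpar.delta_ne_zero
    have n4 := (hval p hp).1
    have n5 := (hval p hp).2
    constructor
    · intro h0
      rw [hf] at h0
      simp only at h0
      rw [h0] at f1
      have : δ₁ ^ 2 / deriv θ p.1 * E.a p.1 ^ 2 ≠ 0 :=
        mul_ne_zero (div_ne_zero (pow_ne_zero 2 n3) n1) (pow_ne_zero 2 n4)
      exact this (by simpa using f1.symm)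
    · rw [hf]
      simp only
      rw [f3]
      exact mul_ne_zero (one_div_ne_zero (mul_ne_zero (pow_ne_zero 2 n2) n1)) n5
  have hsa : ContDiffOn ℝ ∞ (fun p => (f p).1) Ψ.base.source := contDiff_fst.comp_contDiffOn hsm
  -- The formula gives the square of the new a; its sign is constant, as it is continuous and
  -- nonzero on a connected set.
  obtain ⟨A, hA, hfA⟩ := exists_factor_fst hS hsa (by
    intro p hp q hq hpq
    refine eq_of_sq_eq_of_preconnected hc.isPreconnected hsa.continuousOn
      (fun r hr => (hne r hr).1) hp hq ?_
    have e1 := (hform p hp).1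
    have e2 := (hform q hq).1
    simp only [hf]
    rw [e1, e2, hpq])
  obtain ⟨B, hB, hfB⟩ := exists_factor_fst (F := fun p => (f p).2.1) hS
    (contDiff_fst.comp_contDiffOn (contDiff_snd.comp_contDiffOn hsm)) (by
    intro p hp q hq hpq
    have e1 := (hform p hp).2.1
    have e2 := (hform q hq).2.1
    simp only [hf]
    rw [e1, e2, hpq])
  obtain ⟨C, hC, hfC⟩ := exists_factor_fst (F := fun p => (f p).2.2) hS
    (contDiff_snd.comp_contDiffOn (contDiff_snd.comp_contDiffOn hsm)) (by
    intro p hp q hq hpq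
    have e1 := (hform p hp).2.2
    have e2 := (hform q hq).2.2
    simp only [hf]
    rw [e1, e2, hpq])
  have hmaps : ∀ s ∈ θ '' (Prod.fst '' Ψ.base.source), η s ∈ Prod.fst '' Ψ.base.source := by
    rintro _ ⟨t, ht, rfl⟩
    rwa [hηθ t ht]
  refine ⟨{ timeDomain := θ '' (Prod.fst '' Ψ.base.source)
            isOpen_timeDomain := hO
            isConnected_timeDomain := hJc.image _ hpar.smooth_theta.continuousOn
            a := A ∘ η
            b := B ∘ η
            c := C ∘ η
            smooth_a := hA.comp hη hmaps
            smooth_b := hB.comp hη hmaps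
            smooth_c := hC.comp hη hmaps
            a_ne_zero := ?_
            c_ne_zero := ?_ }, ?_, ?_⟩
  · rintro _ ⟨_, ⟨p, hp, rfl⟩, rfl⟩
    simp only [Function.comp, hηθ _ (mem_image_of_mem _ hp), ← hfA p hp]
    exact (hne p hp).1
  · rintro _ ⟨_, ⟨p, hp, rfl⟩, rfl⟩
    simp only [Function.comp, hηθ _ (mem_image_of_mem _ hp), ← hfC p hp]
    exact (hne p hp).2
  · intro p hp
    refine ⟨hE p hp, ?_⟩
    rw [h.1.T_eq hp]
    exact mem_image_of_mem _ (mem_image_of_mem _ hp)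
  · intro p hp
    simp only [Function.comp, h.1.T_eq hp, hηθ _ (mem_image_of_mem _ hp), ← hfA p hp,
      ← hfB p hp, ← hfC p hp, hf]

theorem mem_equivalenceGroup_iff :
    Ψ ∈ equivalenceGroup ↔ IsConnected Ψ.base.source ∧ ∃ (θ φ : ℝ → ℝ) (δ₁ δ₂ : ℝ),
      IsParameters (Prod.fst '' Ψ.base.source) θ φ δ₁ ∧ Ψ.IsGivenBy θ φ δ₁ δ₂ := by
  refine ⟨fun h => ⟨h.1, exists_isGivenBy h⟩, ?_⟩
  rintro ⟨hc, θ, φ, δ₁, δ₂, hpar, h⟩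
  refine ⟨hc, fun E hE => ?_⟩
  obtain ⟨E', ht⟩ := h.exists_target hc hpar hE
  exact ⟨E', ht, h.mapsEquation hpar ht⟩

theorem exists_mem_equivalenceGroup {Ω : Set Base} (hΩ : IsOpen Ω) (hc : IsConnected Ω)
    (hpar : IsParameters (Prod.fst '' Ω) θ φ δ₁) (hpos : ∀ t ∈ Prod.fst '' Ω, 0 < deriv θ t)
    (δ₂ : ℝ) : ∃ Ψ ∈ equivalenceGroup, Ψ.base.source = Ω ∧ Ψ.IsGivenBy θ φ δ₁ δ₂ := by
  obtain ⟨Φ, rfl, hf⟩ := exists_pointTransformation hΩ hc hpar hpos δ₂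
  have dθ : ContDiffOn ℝ ∞ (deriv θ) (Prod.fst '' Φ.source) :=
    hpar.smooth_theta.deriv_of_isOpen (isOpen_image_fst hΩ) le_rfl
  obtain ⟨Ψ, rfl, hg, -⟩ := hf.exists_extension hpar (k₁ := fun t => δ₁ / √(deriv θ t))
    (contDiffOn_const.div (dθ.sqrt fun t ht => (hpos t ht).ne')
      fun t ht => (Real.sqrt_pos.2 (hpos t ht)).ne')
    (fun t ht => by rw [div_pow, Real.sq_sqrt (hpos t ht).le])
  exact ⟨Ψ, mem_equivalenceGroup_iff.2 ⟨hc, θ, φ, δ₁, δ₂, hpar, hg⟩, rfl, hg⟩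

theorem mem_equivalenceGroupoid_iff {Φ : PointTransformation Base} :
    (E, E', Φ) ∈ equivalenceGroupoid ↔
      IsConnected Φ.source ∧ Fits Φ E E' ∧ ∃ (θ φ : ℝ → ℝ) (δ₁ δ₂ : ℝ),
        IsParameters (Prod.fst '' Φ.source) θ φ δ₁ ∧ HasForm Φ θ φ δ₁ δ₂ ∧
        ∀ t ∈ Prod.fst '' Φ.source,
          ElementFormulas θ φ δ₁ t (E.a t, E.b t, E.c t) (E'.a (θ t), E'.b (θ t), E'.c (θ t)) := by
  constructor
  · rintro ⟨hc, hm⟩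
    obtain ⟨θ, φ, δ₁, δ₂, hpar, hf⟩ := hm.exists_form hc
    refine ⟨hc, hm.1, θ, φ, δ₁, δ₂, hpar, hf, ?_⟩
    rintro _ ⟨p, hp, rfl⟩
    exact hf.elementFormulas hpar hm hp
  · rintro ⟨hc, hfit, θ, φ, δ₁, δ₂, hpar, hf, hel⟩
    exact ⟨hc, hf.mapsEquation hpar hfit fun p hp => hel _ (mem_image_of_mem _ hp)⟩

/-- The class is normalized. -/
theorem mem_equivalenceGroupoid_iff_exists {Φ : PointTransformation Base} :
    (E, E', Φ) ∈ equivalenceGroupoid ↔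
      ∃ Ψ ∈ equivalenceGroup, Ψ.base = Φ ∧ Ψ.TransformsElements E E' := by
  constructor
  · intro hg
    obtain ⟨hc, hfit, θ, φ, δ₁, δ₂, hpar, hf, hel⟩ := mem_equivalenceGroupoid_iff.1 hg
    have hJE : ∀ t ∈ Prod.fst '' Φ.source, t ∈ E.timeDomain := by
      rintro _ ⟨p, hp, rfl⟩
      exact (hfit p hp).1
    have hJE' : ∀ t ∈ Prod.fst '' Φ.source, θ t ∈ E'.timeDomain := by
      rintro _ ⟨p, hp, rfl⟩
      rw [← hf.T_eq hp]
      exact (hfit p hp).2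
    -- The root a'(θ)/a of δ₁²/θ_t, rather than δ₁/√θ_t, so that a itself, and not only a², is sent
    -- to a'.
    obtain ⟨Ψ, rfl, hΨ, ha⟩ := hf.exists_extension hpar (k₁ := fun t => E'.a (θ t) / E.a t)
      ((E'.smooth_a.comp hpar.smooth_theta hJE').div (E.smooth_a.mono hJE)
        fun t ht => E.a_ne_zero _ (hJE t ht))
      (fun t ht => by
        have h0 := E.a_ne_zero _ (hJE t ht)
        rw [div_pow, (hel t ht).1]
        field_simp)
    refine ⟨Ψ, mem_equivalenceGroup_iff.2 ⟨hc, θ, φ, δ₁, δ₂, hpar, hΨ⟩, rfl, hfit, ?_⟩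
    intro p hp
    have hm := mem_image_of_mem Prod.fst hp
    have h0 := E.a_ne_zero _ (hJE _ hm)
    obtain ⟨-, g2, g3⟩ := hΨ.2 p hp (E.a p.1, E.b p.1, E.c p.1) ⟨h0, E.c_ne_zero _ (hJE _ hm)⟩
    obtain ⟨-, e2, e3⟩ := hel _ hm
    rw [hf.T_eq hp]
    refine Prod.ext ?_ (Prod.ext (g2.trans e2.symm) (g3.trans e3.symm))
    rw [ha]
    exact div_mul_cancel₀ _ h0
  · rintro ⟨Ψ, hΨ, rfl, ht⟩
    obtain ⟨hc, θ, φ, δ₁, δ₂, hpar, h⟩ := mem_equivalenceGroup_iff.1 hΨ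
    exact ⟨hc, h.mapsEquation hpar ht⟩

end Group

end NWS

theorem theorem1 :
    -- the transformations that constitute the equivalence group
    (∀ Ψ : NWS.ExtendedTransformation,
      Ψ ∈ NWS.equivalenceGroup ↔
        IsConnected Ψ.base.source ∧ ∃ (θ φ : ℝ → ℝ) (δ₁ δ₂ : ℝ),
          NWS.IsParameters (Prod.fst '' Ψ.base.source) θ φ δ₁ ∧ Ψ.IsGivenBy θ φ δ₁ δ₂) ∧
    -- all parameters occur (with `θ_t > 0`, as the formula for the squares requires)
    (∀ (Ω : Set NWS.Base), IsOpen Ω → IsConnected Ω → ∀ (θ φ : ℝ → ℝ) (δ₁ δ₂ : ℝ),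
      NWS.IsParameters (Prod.fst '' Ω) θ φ δ₁ → (∀ t ∈ Prod.fst '' Ω, 0 < deriv θ t) →
        ∃ Ψ ∈ NWS.equivalenceGroup, Ψ.base.source = Ω ∧ Ψ.IsGivenBy θ φ δ₁ δ₂) ∧
    -- the equivalence group generates the equivalence groupoid: the class is normalized
    (∀ (E E' : NWS.Equation) (Φ : NWS.PointTransformation NWS.Base),
      (E, E', Φ) ∈ NWS.equivalenceGroupoid ↔
        ∃ Ψ ∈ NWS.equivalenceGroup, Ψ.base = Φ ∧ Ψ.TransformsElements E E') ∧
    -- the explicit form of the equivalence groupoid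
    (∀ (E E' : NWS.Equation) (Φ : NWS.PointTransformation NWS.Base),
      (E, E', Φ) ∈ NWS.equivalenceGroupoid ↔
        IsConnected Φ.source ∧ NWS.Fits Φ E E' ∧ ∃ (θ φ : ℝ → ℝ) (δ₁ δ₂ : ℝ),
          NWS.IsParameters (Prod.fst '' Φ.source) θ φ δ₁ ∧ NWS.HasForm Φ θ φ δ₁ δ₂ ∧
          ∀ t ∈ Prod.fst '' Φ.source,
            NWS.ElementFormulas θ φ δ₁ t (E.a t, E.b t, E.c t)
              (E'.a (θ t), E'.b (θ t), E'.c (θ t))) :=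
  ⟨fun _ => NWS.mem_equivalenceGroup_iff,
    fun _ hΩ hc _ _ _ δ₂ hpar hpos => NWS.exists_mem_equivalenceGroup hΩ hc hpar hpos δ₂,
    fun _ _ _ => NWS.mem_equivalenceGroupoid_iff_exists,
    fun _ _ _ => NWS.mem_equivalenceGroupoid_iff⟩
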